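/- Let $n\ge 1$. There is a constant $c=c(n)>0$ such that for all real $A$ and $L$ there is $R_0=R_0(n,A,L)>0$ with the following property. Let $V:\mathbb R^n\times[0,1]\to\mathbb C$ be measurable with $\|V\|_{L^\infty(\mathbb R^n\times[0,1])}\le L$, and let $u\in C([0,1]:H^1(\mathbb R^n))$ be a (complex-valued) strong solution of $$i\partial_t u+\Delta u+Vu=0,\qquad x\in\mathbb R^n,\ t\in[0,1],$$ that is, $u$ belongs to $C([0,1]:H^1(\mathbb R^n))$ and satisfies the equation in the sense of distributions on $\mathbb R^n\times(0,1)$. Suppose that $$\int_0^1\int_{\mathbb R^n}\big(|u|^2+|\nabla_x u|^2\big)(x,t)\,dx\,dt\le A^2 \qquad\text{and}\qquad \int_{1/2-1/8}^{1/2+1/8}\int_{|x|<1}|u|^2(x,t)\,dx\,dt\ge 1 .$$ Then for every $R\ge R_0$, $$\delta(R):=\Big(\int_0^1\int_{R-1<|x|<R}\big(|u|^2+|\nabla_x u|^2\big)(x,t)\,dx\,dt\Big)^{1/2}\ \ge\ c\,e^{-cR^2}.$$ -/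

import Mathlib

open MeasureTheory Filter Topology
open scoped ContDiff InnerProductSpace

noncomputable section

/-- Lebesgue measure on the space-time strip `[0,1] × ℝⁿ`; a point is written `(t, x)`. -/
def stripMeasure (n : ℕ) : Measure (ℝ × EuclideanSpace ℝ (Fin n)) :=
  (volume.restrict (Set.Icc (0 : ℝ) 1)).prod volume

/-- `g = (∂₁f, …, ∂ₙf)` in the sense of distributions on `ℝⁿ` (used for `f, g ∈ L²`):
`∫ f ∂ⱼφ = - ∫ gⱼ φ` for all `φ ∈ C_c^∞(ℝⁿ)` and all `j`. -/
def HasWeakGradient {n : ℕ} (f : EuclideanSpace ℝ (Fin n) → ℂ)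
    (g : EuclideanSpace ℝ (Fin n) → EuclideanSpace ℂ (Fin n)) : Prop :=
  ∀ φ : EuclideanSpace ℝ (Fin n) → ℂ, ContDiff ℝ ∞ φ → HasCompactSupport φ →
    ∀ j : Fin n,
      ∫ x, f x * fderiv ℝ φ x (EuclideanSpace.single j 1) = - ∫ x, g x j * φ x

/-- `u ∈ C([0,1] : H¹(ℝⁿ))` with spatial weak gradient `Du`: (jointly measurable) representatives
such that, for each `t ∈ [0,1]`, `u t` and its weak gradient `Du t` are in `L²(ℝⁿ)`, and
`t ↦ u t` is continuous on `[0,1]` in the norm of `H¹(ℝⁿ)`, i.e. `u` and `Du` are continuous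
in the norm of `L²(ℝⁿ)`. -/
structure IsContinuousH1Curve {n : ℕ} (u : ℝ → EuclideanSpace ℝ (Fin n) → ℂ)
    (Du : ℝ → EuclideanSpace ℝ (Fin n) → EuclideanSpace ℂ (Fin n)) : Prop where
  aestronglyMeasurable_fun :
    AEStronglyMeasurable (fun p : ℝ × EuclideanSpace ℝ (Fin n) => u p.1 p.2) (stripMeasure n)
  aestronglyMeasurable_grad :
    AEStronglyMeasurable (fun p : ℝ × EuclideanSpace ℝ (Fin n) => Du p.1 p.2) (stripMeasure n)
  memLp_fun : ∀ t ∈ Set.Icc (0 : ℝ) 1, MemLp (u t) 2 volume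
  memLp_grad : ∀ t ∈ Set.Icc (0 : ℝ) 1, MemLp (Du t) 2 volume
  hasWeakGradient : ∀ t ∈ Set.Icc (0 : ℝ) 1, HasWeakGradient (u t) (Du t)
  tendsto_fun : ∀ t₀ ∈ Set.Icc (0 : ℝ) 1,
    Tendsto (fun t => eLpNorm (fun x => u t x - u t₀ x) 2 volume)
      (𝓝[Set.Icc (0 : ℝ) 1] t₀) (𝓝 0)
  tendsto_grad : ∀ t₀ ∈ Set.Icc (0 : ℝ) 1,
    Tendsto (fun t => eLpNorm (fun x => Du t x - Du t₀ x) 2 volume)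
      (𝓝[Set.Icc (0 : ℝ) 1] t₀) (𝓝 0)

/-- `i ∂ₜu + Δu + V u = 0` in the sense of distributions on `(0,1) × ℝⁿ`:
`∫∫ u (-i ∂ₜψ + Δψ + V ψ) dx dt = 0` for all `ψ ∈ C_c^∞((0,1) × ℝⁿ)`. -/
def SatisfiesSchrodinger {n : ℕ} (V u : ℝ → EuclideanSpace ℝ (Fin n) → ℂ) : Prop :=
  ∀ ψ : ℝ × EuclideanSpace ℝ (Fin n) → ℂ, ContDiff ℝ ∞ ψ → HasCompactSupport ψ →
    tsupport ψ ⊆ Set.Ioo (0 : ℝ) 1 ×ˢ Set.univ →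
    ∫ p, u p.1 p.2 *
        (-Complex.I * deriv (fun s => ψ (s, p.2)) p.1
          + Laplacian.laplacian (fun y => ψ (p.1, y)) p.2
          + V p.1 p.2 * ψ p) ∂(stripMeasure n) = 0

/-- `u ∈ C([0,1] : H¹(ℝⁿ))`, with spatial gradient `Du`, is a strong solution of
`i ∂ₜu + Δu + V u = 0`. For bounded `V` and `u` in this class, the equation in the sense of
distributions is equivalent to the equation in `H⁻¹(ℝⁿ)` for a.e. `t` and to Duhamel's formula. -/
structure IsStrongSolution {n : ℕ} (V u : ℝ → EuclideanSpace ℝ (Fin n) → ℂ)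
    (Du : ℝ → EuclideanSpace ℝ (Fin n) → EuclideanSpace ℂ (Fin n)) : Prop where
  curve : IsContinuousH1Curve u Du
  equation : SatisfiesSchrodinger V u

/-- `δ(R)`, the `L²` norm of `(u, ∇u)` on `{R - 1 < |x| < R} × [0,1]`. -/
def annulusNorm {n : ℕ} (u : ℝ → EuclideanSpace ℝ (Fin n) → ℂ)
    (Du : ℝ → EuclideanSpace ℝ (Fin n) → EuclideanSpace ℂ (Fin n)) (R : ℝ) : ℝ :=
  Real.sqrt (∫ t in (0 : ℝ)..1,
    ∫ x in {x : EuclideanSpace ℝ (Fin n) | R - 1 < ‖x‖ ∧ ‖x‖ < R}, (‖u t x‖ ^ 2 + ‖Du t x‖ ^ 2))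

end

/-! The proof is a Carleman estimate with a weight that is convex in space and concave in time. Put
`X = x_i + 2R` for one coordinate `x_i`, and `w = 2 (X² - 48 R² (t - 1/2)²)`. Conjugating `i∂_t + Δ`
by `exp w` gives `S + K` with `S` symmetric and `K` antisymmetric, and `‖(S + K)f‖² = ‖(S - K)f‖² +
4 Re⟨Sf, Kf⟩`. Integration by parts turns the last term into a nonnegative gradient term plus the
integral of `(64 α³ X² + 2κ)|f|²`, where `α = 2` and `κ = ∂_t² w = -192 R²` (`carleman_conjugated`,
`carleman_real`). The shift by `2R` keeps `X ≥ R` on `|x| < R`, so the coefficient is at least `128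
R²` there, despite the concavity in time.

The estimate is applied to `η u`, with `η` cutting off to `|x| < R` and to times away from `0` and
`1` (`exists_spacetime_cutoff`). For `R` large against `‖V‖_∞` the potential is absorbed by the left
side. The commutator with `η` leaves errors in two places: where `|t - 1/2| ≥ 3/8`, and where `R - 1
< |x| < R`. The number `48` is tuned so that `exp (2w)` is at least `exp (10R²)` on the cylinder
carrying mass one, at most `exp (9R²)` at the far times, and at most `exp (36R²)` on all of `|x| <
R`. Hence (`IsStrongSolution.mass_le`) `R² e^{10R²} ≤ K e^{9R²} A² + K e^{36R²} δ(R)²`. For large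
`R` the middle term is absorbed, and `δ(R)` is at least a constant times `e^{-13R²}`.

Since `u` is only a weak solution, the estimate is first proved for smooth functions
(`carleman_cutoff`), then applied to space-time mollifications of `u` and passed to the limit in
`L²` (`carleman_weak`). The cut-off inequality contains only `U`, its spatial gradient and `(i∂_t +
Δ)U`, all of which are `L²` limits on the relevant sets. -/

noncomputable section

/-! ### Calculus of directional derivatives and test functions. -/

section TestFunctions

variable {G : Type*} [NormedAddCommGroup G] [NormedSpace ℝ G]
  {F : Type*} [NormedAddCommGroup F] [NormedSpace ℝ F]

/-- The derivative of `f` in the direction `v`, as a function. -/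
def dirDeriv (v : G) (f : G → F) : G → F := fun p => fderiv ℝ f p v

/-- Smooth functions with compact support. -/
structure IsTest (f : G → F) : Prop where
  smooth : ContDiff ℝ ∞ f
  supp : HasCompactSupport f

theorem contDiff_dirDeriv {f : G → F} (hf : ContDiff ℝ ∞ f) (v : G) :
    ContDiff ℝ ∞ (dirDeriv v f) :=
  (hf.fderiv_right (m := ∞) (by simp)).clm_apply contDiff_const

theorem ContDiff.differentiable_of_smooth {f : G → F} (hf : ContDiff ℝ ∞ f) :
    Differentiable ℝ f := hf.differentiable (by simp)

theorem IsTest.deriv {f : G → F} (hf : IsTest f) (v : G) : IsTest (dirDeriv v f) :=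
  ⟨contDiff_dirDeriv hf.smooth v, hf.supp.fderiv_apply (𝕜 := ℝ) v⟩

theorem IsTest.mul_left {f : G → ℝ} (hf : IsTest f) {g : G → ℝ} (hg : ContDiff ℝ ∞ g) :
    IsTest (fun p => g p * f p) :=
  ⟨hg.mul hf.smooth, hf.supp.mul_left⟩

theorem IsTest.mul_right {f : G → ℝ} (hf : IsTest f) {g : G → ℝ} (hg : ContDiff ℝ ∞ g) :
    IsTest (fun p => f p * g p) :=
  ⟨hf.smooth.mul hg, hf.supp.mul_right⟩

theorem IsTest.add {f g : G → F} (hf : IsTest f) (hg : IsTest g) : IsTest (fun p => f p + g p) :=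
  ⟨hf.smooth.add hg.smooth, hf.supp.add hg.supp⟩

theorem IsTest.neg {f : G → F} (hf : IsTest f) : IsTest (fun p => - f p) :=
  ⟨hf.smooth.neg, hf.supp.comp_left (g := fun x : F => -x) (by simp)⟩

theorem IsTest.sub {f g : G → F} (hf : IsTest f) (hg : IsTest g) : IsTest (fun p => f p - g p) := by
  simpa only [sub_eq_add_neg] using hf.add hg.neg

theorem IsTest.sum {ι : Type*} (s : Finset ι) {f : ι → G → F} (hf : ∀ i, IsTest (f i)) :
    IsTest (fun p => ∑ i ∈ s, f i p) := by
  classical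
  induction s using Finset.induction_on with
  | empty => exact ⟨by simpa using contDiff_const, by simp [HasCompactSupport, tsupport]⟩
  | insert a s ha ih => simpa [Finset.sum_insert ha] using (hf a).add ih

theorem dirDeriv_mul {f g : G → ℝ} (hf : Differentiable ℝ f) (hg : Differentiable ℝ g)
    (v p : G) : dirDeriv v (fun q => f q * g q) p = dirDeriv v f p * g p + f p * dirDeriv v g p := by
  simp only [dirDeriv]
  rw [fderiv_fun_mul (hf p) (hg p)]
  simp; ring

theorem dirDeriv_add {f g : G → F} (hf : Differentiable ℝ f) (hg : Differentiable ℝ g)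
    (v p : G) : dirDeriv v (fun q => f q + g q) p = dirDeriv v f p + dirDeriv v g p := by
  simp only [dirDeriv]
  rw [fderiv_fun_add (hf p) (hg p)]
  simp

theorem dirDeriv_sub {f g : G → F} (hf : Differentiable ℝ f) (hg : Differentiable ℝ g)
    (v p : G) : dirDeriv v (fun q => f q - g q) p = dirDeriv v f p - dirDeriv v g p := by
  simp only [dirDeriv]
  rw [fderiv_fun_sub (hf p) (hg p)]
  simp

theorem dirDeriv_const (c : F) (v p : G) : dirDeriv v (fun _ : G => c) p = 0 := by
  simp [dirDeriv]

theorem dirDeriv_pow {f : G → ℝ} (hf : Differentiable ℝ f) (m : ℕ)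
    (v p : G) : dirDeriv v (fun q => f q ^ m) p = m * f p ^ (m - 1) * dirDeriv v f p := by
  simp only [dirDeriv]
  rw [fderiv_fun_pow m (hf p)]
  simp

theorem dirDeriv_exp {w : G → ℝ} (hw : Differentiable ℝ w) (v p : G) :
    dirDeriv v (fun q => Real.exp (w q)) p = Real.exp (w p) * dirDeriv v w p := by
  simp only [dirDeriv]
  rw [fderiv_exp (hw p)]
  simp

theorem dirDeriv_dirDeriv {f : G → F} (hf : ContDiff ℝ ∞ f) (v w p : G) :
    dirDeriv v (dirDeriv w f) p = fderiv ℝ (fderiv ℝ f) p v w := by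
  have h1 : DifferentiableAt ℝ (fderiv ℝ f) p :=
    (hf.fderiv_right (m := ∞) (by simp)).differentiable_of_smooth p
  change fderiv ℝ (fun y => fderiv ℝ f y w) p v = _
  rw [fderiv_clm_apply h1 (differentiableAt_const w)]
  simp

theorem dirDeriv_comm {f : G → F} (hf : ContDiff ℝ ∞ f) (v w p : G) :
    dirDeriv v (dirDeriv w f) p = dirDeriv w (dirDeriv v f) p := by
  rw [dirDeriv_dirDeriv hf, dirDeriv_dirDeriv hf]
  exact (hf.contDiffAt.isSymmSndFDerivAt (by
    simp only [minSmoothness_of_isRCLikeNormedField]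
    exact WithTop.coe_le_coe.2 (le_top : (2 : ℕ∞) ≤ ⊤))) v w

end TestFunctions

/-! ### Divergences of test functions integrate to zero. -/

section ZeroMean

variable {G : Type*} [MeasurableSpace G]

/-- Integrable functions of vanishing integral. -/
def HasZeroMean (μ : Measure G) (f : G → ℝ) : Prop := Integrable f μ ∧ ∫ p, f p ∂μ = 0

variable {μ : Measure G}

theorem HasZeroMean.add {f g : G → ℝ} (hf : HasZeroMean μ f) (hg : HasZeroMean μ g) :
    HasZeroMean μ (fun p => f p + g p) :=
  ⟨hf.1.add hg.1, by rw [integral_add hf.1 hg.1, hf.2, hg.2, add_zero]⟩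

theorem HasZeroMean.sum {ι : Type*} (s : Finset ι) {f : ι → G → ℝ}
    (hf : ∀ i, HasZeroMean μ (f i)) : HasZeroMean μ (fun p => ∑ i ∈ s, f i p) :=
  ⟨integrable_finsetSum _ fun i _ => (hf i).1, by
    rw [integral_finsetSum _ fun i _ => (hf i).1]; simp [(hf _).2]⟩

variable [NormedAddCommGroup G] [NormedSpace ℝ G] [BorelSpace G]

theorem IsTest.integrable {F : Type*} [NormedAddCommGroup F] [NormedSpace ℝ F]
    [IsFiniteMeasureOnCompacts μ] {f : G → F} (hf : IsTest f) : Integrable f μ :=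
  hf.smooth.continuous.integrable_of_hasCompactSupport hf.supp

theorem IsTest.hasZeroMean [FiniteDimensional ℝ G] [μ.IsAddHaarMeasure] {f : G → ℝ}
    (hf : IsTest f) (v : G) : HasZeroMean μ (dirDeriv v f) := by
  refine ⟨(hf.deriv v).integrable, ?_⟩
  have h0 : Integrable (fun x => fderiv ℝ f x v) μ := (hf.deriv v).integrable
  -- Integration by parts against the constant function one.
  have h := integral_mul_fderiv_eq_neg_fderiv_mul_of_integrable (μ := μ) (𝕜 := ℝ)
    (f := fun _ => 1) (g := f) (v := v) (by simp)
    (by simpa using h0) (by simpa using hf.integrable)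
    (fun x _ => differentiableAt_const _) (fun x _ => hf.smooth.differentiable_of_smooth x)
  simpa [dirDeriv] using h

end ZeroMean

/-! ### The Carleman inequality for real and imaginary parts. -/

section Carleman

variable {G : Type*} [NormedAddCommGroup G] [NormedSpace ℝ G] [FiniteDimensional ℝ G]
  [MeasurableSpace G] [BorelSpace G] {μ : Measure G} [μ.IsAddHaarMeasure]
  {ι : Type*} [DecidableEq ι]

/-- Commutator of `∂_j²` with `-4αX∂_i - 2α`: the expression is the exact divergence `∂_j(∂_j a
(-4αX ∂_i a - 2αa)) + ∂_i(2αX (∂_j a)²)`. Only `j = i` sees the derivative of `X`, and it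
contributes with a good sign. -/
theorem hasZeroMean_second_deriv_mul {a X : G → ℝ} (ha : IsTest a) (hX : ContDiff ℝ ∞ X)
    {e : ι → G} {i : ι} (hXe : ∀ j p, dirDeriv (e j) X p = if j = i then 1 else 0) (α : ℝ) (j : ι) :
    HasZeroMean μ (fun p => dirDeriv (e j) (dirDeriv (e j) a) p *
      (-4 * α * X p * dirDeriv (e i) a p - 2 * α * a p)
      - if j = i then 4 * α * dirDeriv (e i) a p ^ 2 else 0) := by
  have hj := ha.deriv (e j)
  have hi := ha.deriv (e i)
  have s0 := ha.smooth
  have sj := hj.smooth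
  have si := hi.smooth
  have d0 := s0.differentiable_of_smooth
  have dj := sj.differentiable_of_smooth
  have di := si.differentiable_of_smooth
  have dX := hX.differentiable_of_smooth
  have h1 : IsTest (fun p => dirDeriv (e j) a p *
      (-4 * α * X p * dirDeriv (e i) a p - 2 * α * a p)) :=
    hj.mul_right (by fun_prop)
  have h2 : IsTest (fun p => dirDeriv (e j) a p * (2 * α * X p * dirDeriv (e j) a p)) :=
    hj.mul_right (by fun_prop)
  convert (h1.hasZeroMean (μ := μ) (e j)).add (h2.hasZeroMean (e i)) using 2 with p
  simp (disch := fun_prop) only [dirDeriv_mul, dirDeriv_sub, dirDeriv_const, hXe]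
  rw [dirDeriv_comm s0 (e i) (e j)]
  by_cases h : j = i
  · subst h; simp; ring
  · simp [h]; ring

/-- Multiplication by `W` commutes with `∂_v²` because `W` is constant along `v`, so this pairing of
`S` with `K` contributes nothing. -/
theorem hasZeroMean_second_deriv_cross {a b W : G → ℝ} (ha : IsTest a) (hb : IsTest b)
    (hW : ContDiff ℝ ∞ W) {v : G} (hWv : ∀ p, dirDeriv v W p = 0) :
    HasZeroMean μ (fun p => dirDeriv v (dirDeriv v a) p * (W p * b p)
      - dirDeriv v (dirDeriv v b) p * (W p * a p)) := by
  have ha' := (ha.deriv v).smooth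
  have hb' := (hb.deriv v).smooth
  have s0 := ha.smooth
  have s1 := hb.smooth
  have d0 := s0.differentiable_of_smooth
  have d1 := s1.differentiable_of_smooth
  have d2 := ha'.differentiable_of_smooth
  have d3 := hb'.differentiable_of_smooth
  have dW := hW.differentiable_of_smooth
  have h1 : IsTest (fun p => a p * (W p * dirDeriv v b p)) := ha.mul_right (by fun_prop)
  have h2 : IsTest (fun p => b p * (W p * dirDeriv v a p)) := hb.mul_right (by fun_prop)
  convert ((h2.sub h1).hasZeroMean (μ := μ) v) using 2 with p
  simp (disch := fun_prop) only [dirDeriv_mul, dirDeriv_sub, hWv]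
  ring

/-- Commutator of `i∂_τ` with `K`. The first-order part of `K` does not depend on time and drops
out; the part `-iW` leaves `∂_τ W = κ`, the only term of possibly negative sign. -/
theorem hasZeroMean_time_deriv {a b X W : G → ℝ} (ha : IsTest a) (hb : IsTest b)
    (hX : ContDiff ℝ ∞ X) (hW : ContDiff ℝ ∞ W) {τ v : G} {κ : ℝ}
    (hXv : ∀ p, dirDeriv v X p = 1) (hXτ : ∀ p, dirDeriv τ X p = 0)
    (hWτ : ∀ p, dirDeriv τ W p = κ) (α : ℝ) :
    HasZeroMean μ (fun p =>
      -dirDeriv τ b p * (-4 * α * X p * dirDeriv v a p - 2 * α * a p + W p * b p)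
      + dirDeriv τ a p * (-4 * α * X p * dirDeriv v b p - 2 * α * b p - W p * a p)
      - κ / 2 * (a p ^ 2 + b p ^ 2)) := by
  have ha' := (ha.deriv v).smooth
  have hb' := (hb.deriv v).smooth
  have ha'' := (ha.deriv τ).smooth
  have hb'' := (hb.deriv τ).smooth
  have s0 := ha.smooth
  have s1 := hb.smooth
  have d0 := s0.differentiable_of_smooth
  have d1 := s1.differentiable_of_smooth
  have d2 := ha'.differentiable_of_smooth
  have d3 := hb'.differentiable_of_smooth
  have d4 := ha''.differentiable_of_smooth
  have d5 := hb''.differentiable_of_smooth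
  have dW := hW.differentiable_of_smooth
  have dX := hX.differentiable_of_smooth
  have h1 : IsTest (fun p => 2 * α * X p * dirDeriv τ b p * a p) := ha.mul_left (by fun_prop)
  have h2 : IsTest (fun p => 2 * α * X p * dirDeriv τ a p * b p) := hb.mul_left (by fun_prop)
  have h3 : IsTest (fun p => 2 * α * X p * dirDeriv v a p * b p) := hb.mul_left (by fun_prop)
  have h4 : IsTest (fun p => 2 * α * X p * dirDeriv v b p * a p) := ha.mul_left (by fun_prop)
  have h5 : IsTest (fun p => -(1 / 2) * W p * a p * a p) := ha.mul_left (by fun_prop)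
  have h6 : IsTest (fun p => -(1 / 2) * W p * b p * b p) := hb.mul_left (by fun_prop)
  convert ((h1.sub h2).hasZeroMean (μ := μ) v).add
    (((h3.sub h4).add (h5.add h6)).hasZeroMean (μ := μ) τ) using 2 with p
  simp (disch := fun_prop) only [dirDeriv_mul, dirDeriv_sub, dirDeriv_add, hXv, hXτ, hWτ,
    dirDeriv_const]
  rw [dirDeriv_comm s0 v τ, dirDeriv_comm s1 v τ]
  ring

/-- Commutator of `|∇w|² = 4α²X²` with the first-order part of `K`; the expression is
`∂_v(-8α³X³a²)`. It supplies the large positive term that dominates `κ`. -/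
theorem hasZeroMean_cubic_mul {a X : G → ℝ} (ha : IsTest a) (hX : ContDiff ℝ ∞ X) {v : G}
    (hXv : ∀ p, dirDeriv v X p = 1) (α : ℝ) :
    HasZeroMean μ (fun p =>
      4 * α ^ 2 * X p ^ 2 * a p * (-4 * α * X p * dirDeriv v a p - 2 * α * a p)
      - 16 * α ^ 3 * X p ^ 2 * a p ^ 2) := by
  have s0 := ha.smooth
  have d0 := s0.differentiable_of_smooth
  have dX := hX.differentiable_of_smooth
  have h1 : IsTest (fun p => -8 * α ^ 3 * X p * X p * X p * a p * a p) :=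
    ha.mul_left (by fun_prop)
  convert h1.hasZeroMean (μ := μ) v using 2 with p
  simp (disch := fun_prop) only [dirDeriv_mul, hXv, dirDeriv_const]
  ring

variable [Fintype ι]

/-- The Carleman inequality after conjugation with the weight: `S + K` is the conjugated operator
acting on `a + i b`, and the commutator of `S` and `K` is bounded from below. -/
theorem carleman_conjugated {a b X W : G → ℝ} (ha : IsTest a) (hb : IsTest b)
    (hX : ContDiff ℝ ∞ X) (hW : ContDiff ℝ ∞ W) {τ : G} {e : ι → G} {i : ι} {κ α : ℝ}
    (hα : 0 ≤ α)
    (hXe : ∀ j p, dirDeriv (e j) X p = if j = i then 1 else 0) (hXτ : ∀ p, dirDeriv τ X p = 0)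
    (hWe : ∀ j p, dirDeriv (e j) W p = 0) (hWτ : ∀ p, dirDeriv τ W p = κ) :
    ∫ p, (64 * α ^ 3 * X p ^ 2 + 2 * κ) * (a p ^ 2 + b p ^ 2) ∂μ ≤
    ∫ p, ((-dirDeriv τ b p + ∑ j, dirDeriv (e j) (dirDeriv (e j) a) p + 4 * α ^ 2 * X p ^ 2 * a p
        + (-4 * α * X p * dirDeriv (e i) a p - 2 * α * a p + W p * b p)) ^ 2
      + (dirDeriv τ a p + ∑ j, dirDeriv (e j) (dirDeriv (e j) b) p + 4 * α ^ 2 * X p ^ 2 * b p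
        + (-4 * α * X p * dirDeriv (e i) b p - 2 * α * b p - W p * a p)) ^ 2) ∂μ := by
  have hXi : ∀ p, dirDeriv (e i) X p = 1 := fun p => by simp [hXe]
  have s0 := ha.smooth
  have s1 := hb.smooth
  have si0 := (ha.deriv (e i)).smooth
  have si1 := (hb.deriv (e i)).smooth
  have hLa : IsTest (fun p => ∑ j, dirDeriv (e j) (dirDeriv (e j) a) p) :=
    IsTest.sum _ fun j => (ha.deriv _).deriv _
  have hLb : IsTest (fun p => ∑ j, dirDeriv (e j) (dirDeriv (e j) b) p) :=
    IsTest.sum _ fun j => (hb.deriv _).deriv _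
  have hKa : IsTest (fun p => -4 * α * X p * dirDeriv (e i) a p - 2 * α * a p + W p * b p) :=
    (((ha.deriv (e i)).mul_left (by fun_prop)).sub (ha.mul_left (by fun_prop))).add
      (hb.mul_left hW)
  have hKb : IsTest (fun p => -4 * α * X p * dirDeriv (e i) b p - 2 * α * b p - W p * a p) :=
    (((hb.deriv (e i)).mul_left (by fun_prop)).sub (hb.mul_left (by fun_prop))).sub
      (ha.mul_left hW)
  have hSa : IsTest (fun p => -dirDeriv τ b p + ∑ j, dirDeriv (e j) (dirDeriv (e j) a) p
      + 4 * α ^ 2 * X p ^ 2 * a p) :=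
    ((hb.deriv τ).neg.add hLa).add (ha.mul_left (by fun_prop))
  have hSb : IsTest (fun p => dirDeriv τ a p + ∑ j, dirDeriv (e j) (dirDeriv (e j) b) p
      + 4 * α ^ 2 * X p ^ 2 * b p) :=
    ((ha.deriv τ).add hLb).add (hb.mul_left (by fun_prop))
  have hTa := hSa.add hKa
  have hTb := hSb.add hKb
  have intT : Integrable (fun p =>
      (-dirDeriv τ b p + ∑ j, dirDeriv (e j) (dirDeriv (e j) a) p + 4 * α ^ 2 * X p ^ 2 * a p
        + (-4 * α * X p * dirDeriv (e i) a p - 2 * α * a p + W p * b p)) ^ 2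
      + (dirDeriv τ a p + ∑ j, dirDeriv (e j) (dirDeriv (e j) b) p + 4 * α ^ 2 * X p ^ 2 * b p
        + (-4 * α * X p * dirDeriv (e i) b p - 2 * α * b p - W p * a p)) ^ 2) μ := by
    simpa only [sq] using
      ((hTa.mul_left hTa.smooth).add (hTb.mul_left hTb.smooth)).integrable (μ := μ)
  have intQ : Integrable (fun p => (64 * α ^ 3 * X p ^ 2 + 2 * κ) * (a p ^ 2 + b p ^ 2)) μ := by
    have h : IsTest (fun p => a p ^ 2 + b p ^ 2) := by
      simpa only [sq] using (ha.mul_left ha.smooth).add (hb.mul_left hb.smooth)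
    exact (h.mul_left (by fun_prop)).integrable
  -- With `f = a + ib`, the sum of these identities says that `Re(Sf · conj(Kf)) - 4α|∂_i f|² -
  -- (16α³X² + κ/2)|f|²` has zero mean.
  have hZ := ((((HasZeroMean.sum Finset.univ fun j =>
    hasZeroMean_second_deriv_mul (μ := μ) ha hX hXe α j).add
    (HasZeroMean.sum Finset.univ fun j =>
      hasZeroMean_second_deriv_mul (μ := μ) hb hX hXe α j)).add
    (HasZeroMean.sum Finset.univ fun j =>
      hasZeroMean_second_deriv_cross (μ := μ) ha hb hW (hWe j))).add
    (hasZeroMean_time_deriv (μ := μ) ha hb hX hW hXi hXτ hWτ α)).add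
    ((hasZeroMean_cubic_mul (μ := μ) ha hX hXi α).add (hasZeroMean_cubic_mul (μ := μ) hb hX hXi α))
  simp only [Finset.sum_sub_distrib, ← Finset.sum_mul, Finset.sum_ite_eq', Finset.mem_univ,
    if_true] at hZ
  -- Pointwise `|Sf + Kf|² = |Sf - Kf|² + 4 Re(Sf · conj(Kf))`; the square `|Sf - Kf|²` and the term
  -- `16α|∂_i f|²` are discarded.
  have := integral_mono (intQ.add (hZ.1.const_mul 4)) intT (fun p => by
    simp only [Pi.add_apply]
    generalize ∑ j, dirDeriv (e j) (dirDeriv (e j) a) p = A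
    generalize ∑ j, dirDeriv (e j) (dirDeriv (e j) b) p = B
    have h1 : 0 ≤ α * dirDeriv (e i) a p ^ 2 := by positivity
    have h2 : 0 ≤ α * dirDeriv (e i) b p ^ 2 := by positivity
    have h3 := sq_nonneg (-dirDeriv τ b p + A + 4 * α ^ 2 * X p ^ 2 * a p
        - (-4 * α * X p * dirDeriv (e i) a p - 2 * α * a p + W p * b p))
    have h4 := sq_nonneg (dirDeriv τ a p + B + 4 * α ^ 2 * X p ^ 2 * b p
        - (-4 * α * X p * dirDeriv (e i) b p - 2 * α * b p - W p * a p))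
    linarith)
  rw [integral_add' intQ (hZ.1.const_mul 4), integral_const_mul, hZ.2] at this
  simpa using this

/-- A Carleman inequality for `i ∂_τ + ∑ ∂_j²`, acting on `a + i b`, with the weight `exp w`;
the function `w` is quadratic in one space variable. -/
theorem carleman_real {a b X w : G → ℝ} (ha : IsTest a) (hb : IsTest b)
    (hX : ContDiff ℝ ∞ X) (hw : ContDiff ℝ ∞ w) {τ : G} {e : ι → G} {i : ι} {κ α : ℝ}
    (hα : 0 ≤ α)
    (hXe : ∀ j p, dirDeriv (e j) X p = if j = i then 1 else 0) (hXτ : ∀ p, dirDeriv τ X p = 0)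
    (hwe : ∀ j p, dirDeriv (e j) w p = if j = i then 2 * α * X p else 0)
    (hwτ : ∀ p, dirDeriv τ (dirDeriv τ w) p = κ) :
    ∫ p, (64 * α ^ 3 * X p ^ 2 + 2 * κ) * (Real.exp (w p) ^ 2 * (a p ^ 2 + b p ^ 2)) ∂μ ≤
    ∫ p, Real.exp (w p) ^ 2 * ((-dirDeriv τ b p + ∑ j, dirDeriv (e j) (dirDeriv (e j) a) p) ^ 2
      + (dirDeriv τ a p + ∑ j, dirDeriv (e j) (dirDeriv (e j) b) p) ^ 2) ∂μ := by
  have hE : ContDiff ℝ ∞ (fun p => Real.exp (w p)) := hw.exp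
  have dw := hw.differentiable_of_smooth
  have dX := hX.differentiable_of_smooth
  have dE := hE.differentiable_of_smooth
  have hwe0 : ∀ j, j ≠ i → dirDeriv (e j) w = fun _ => 0 := fun j hj => by
    ext p; simp [hwe, hj]
  have hwe1 : dirDeriv (e i) w = fun p => 2 * α * X p := by
    ext p; simp [hwe]
  -- The spatial derivatives of `w` are independent of time, so the mixed derivatives vanish.
  have hWe : ∀ j p, dirDeriv (e j) (dirDeriv τ w) p = 0 := by
    intro j p
    rw [dirDeriv_comm hw]
    by_cases hj : j = i
    · subst hj
      rw [hwe1]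
      simp (disch := fun_prop) only [dirDeriv_mul, dirDeriv_const, hXτ]
      simp
    · rw [hwe0 j hj, dirDeriv_const]
  have hmul : ∀ {c : G → ℝ}, IsTest c → ∀ v : G, dirDeriv v (fun p => Real.exp (w p) * c p) =
      fun p => Real.exp (w p) * (dirDeriv v w p * c p + dirDeriv v c p) := by
    intro c hc v
    ext p
    rw [dirDeriv_mul dE hc.smooth.differentiable_of_smooth, dirDeriv_exp dw]
    ring
  have hlap : ∀ {c : G → ℝ}, IsTest c → ∀ p,
      ∑ j, dirDeriv (e j) (dirDeriv (e j) (fun p => Real.exp (w p) * c p)) p =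
      Real.exp (w p) * (∑ j, dirDeriv (e j) (dirDeriv (e j) c) p + 4 * α * X p * dirDeriv (e i) c p
        + (2 * α + 4 * α ^ 2 * X p ^ 2) * c p) := by
    intro c hc p
    have dc := hc.smooth.differentiable_of_smooth
    have key : ∀ j, dirDeriv (e j) (dirDeriv (e j) (fun p => Real.exp (w p) * c p)) p =
        Real.exp (w p) * dirDeriv (e j) (dirDeriv (e j) c) p + if j = i then
          Real.exp (w p) * (4 * α * X p * dirDeriv (e i) c p
            + (2 * α + 4 * α ^ 2 * X p ^ 2) * c p) else 0 := by
      intro j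
      have dcj := (hc.deriv (e j)).smooth.differentiable_of_smooth
      rw [hmul hc]
      by_cases hj : j = i
      · subst hj
        rw [hwe1]
        simp (disch := fun_prop) only [dirDeriv_mul, dirDeriv_add, dirDeriv_exp, dirDeriv_const,
          hXe, hwe1]
        simp
        ring
      · rw [hwe0 j hj]
        simp (disch := fun_prop) only [dirDeriv_mul, dirDeriv_add, dirDeriv_exp, dirDeriv_const,
          hwe0 j hj]
        simp [hj]
    simp only [key, Finset.sum_add_distrib, Finset.sum_ite_eq', Finset.mem_univ, if_true,
      ← Finset.mul_sum]
    ring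
  -- On `exp w · (a + ib)`, with `W = ∂_τ w`, the operator `S + K` equals `exp w` times the
  -- unconjugated operator on `a + ib`.
  have main := carleman_conjugated (μ := μ) (ha.mul_left hE) (hb.mul_left hE) hX
    (contDiff_dirDeriv hw τ)
    hα hXe hXτ hWe hwτ
  refine le_trans (le_of_eq ?_) (main.trans (le_of_eq ?_))
  · congr 1; ext p; ring
  · congr 1; ext p
    rw [hlap ha, hlap hb, hmul ha, hmul hb, hmul ha, hmul hb, hwe1]
    ring

end Carleman

/-! ### The Carleman inequality for complex functions and its cut-off form. -/

section Complex

theorem norm_sum_smul_sq_le {ι : Type*} [Fintype ι] (a : ι → ℝ) (z : ι → ℂ) :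
    ‖∑ j, a j • z j‖ ^ 2 ≤ (∑ j, a j ^ 2) * ∑ j, ‖z j‖ ^ 2 := by
  have h1 : ‖∑ j, a j • z j‖ ≤ ∑ j, |a j| * ‖z j‖ :=
    (norm_sum_le _ _).trans (le_of_eq (by simp))
  calc ‖∑ j, a j • z j‖ ^ 2 ≤ (∑ j, |a j| * ‖z j‖) ^ 2 := by gcongr
    _ ≤ (∑ j, |a j| ^ 2) * ∑ j, ‖z j‖ ^ 2 := Finset.sum_mul_sq_le_sq_mul_sq _ _ _
    _ = _ := by simp

theorem norm_add_three_sq_le (x y z : ℂ) :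
    ‖x + y + z‖ ^ 2 ≤ 3 * (‖x‖ ^ 2 + ‖y‖ ^ 2 + ‖z‖ ^ 2) := by
  have h : ‖x + y + z‖ ≤ ‖x‖ + ‖y‖ + ‖z‖ := norm_add₃_le
  have := norm_nonneg (x + y + z)
  nlinarith [sq_nonneg (‖x‖ - ‖y‖), sq_nonneg (‖y‖ - ‖z‖), sq_nonneg (‖x‖ - ‖z‖)]

theorem norm_add_sq_le_two (x y : ℂ) : ‖x + y‖ ^ 2 ≤ 2 * (‖x‖ ^ 2 + ‖y‖ ^ 2) := by
  have h : ‖x + y‖ ≤ ‖x‖ + ‖y‖ := norm_add_le _ _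
  have := norm_nonneg (x + y)
  nlinarith [sq_nonneg (‖x‖ - ‖y‖)]


variable {G : Type*} [NormedAddCommGroup G] [NormedSpace ℝ G]

theorem dirDeriv_re {f : G → ℂ} (hf : Differentiable ℝ f) (v : G) :
    dirDeriv v (fun p => (f p).re) = fun p => (dirDeriv v f p).re := by
  ext p
  have := (Complex.reCLM.hasFDerivAt.comp p (hf p).hasFDerivAt).fderiv
  change fderiv ℝ (fun p => (f p).re) p = _ at this
  simp [dirDeriv, this]

theorem dirDeriv_im {f : G → ℂ} (hf : Differentiable ℝ f) (v : G) :
    dirDeriv v (fun p => (f p).im) = fun p => (dirDeriv v f p).im := by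
  ext p
  have := (Complex.imCLM.hasFDerivAt.comp p (hf p).hasFDerivAt).fderiv
  change fderiv ℝ (fun p => (f p).im) p = _ at this
  simp [dirDeriv, this]

theorem IsTest.re {f : G → ℂ} (hf : IsTest f) : IsTest (fun p => (f p).re) :=
  ⟨Complex.reCLM.contDiff.comp hf.smooth, hf.supp.comp_left (g := Complex.re) rfl⟩

theorem IsTest.im {f : G → ℂ} (hf : IsTest f) : IsTest (fun p => (f p).im) :=
  ⟨Complex.imCLM.contDiff.comp hf.smooth, hf.supp.comp_left (g := Complex.im) rfl⟩

theorem IsTest.smul {F : Type*} [NormedAddCommGroup F] [NormedSpace ℝ F] {η : G → ℝ}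
    (hη : IsTest η) {f : G → F} (hf : ContDiff ℝ ∞ f) : IsTest (fun p => η p • f p) :=
  ⟨hη.smooth.smul hf, hη.supp.smul_right⟩

theorem dirDeriv_smul {F : Type*} [NormedAddCommGroup F] [NormedSpace ℝ F] {η : G → ℝ} {f : G → F}
    (hη : Differentiable ℝ η) (hf : Differentiable ℝ f) (v p : G) :
    dirDeriv v (fun q => η q • f q) p = dirDeriv v η p • f p + η p • dirDeriv v f p := by
  simp only [dirDeriv]
  rw [fderiv_fun_smul (hη p) (hf p)]
  simp [add_comm]

/-- Product rule that isolates the commutator with the cutoff: every term but the first carries a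
derivative of `η`. -/
theorem schrodinger_smul {ι : Type*} [Fintype ι] {η : G → ℝ} {U : G → ℂ}
    (hη : ContDiff ℝ ∞ η) (hU : ContDiff ℝ ∞ U) (τ : G) (e : ι → G) (p : G) :
    Complex.I * dirDeriv τ (fun q => η q • U q) p
      + ∑ j, dirDeriv (e j) (dirDeriv (e j) (fun q => η q • U q)) p =
    η p • (Complex.I * dirDeriv τ U p + ∑ j, dirDeriv (e j) (dirDeriv (e j) U) p)
      + dirDeriv τ η p • (Complex.I * U p)
      + ((∑ j, dirDeriv (e j) (dirDeriv (e j) η) p) • U p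
        + (2 : ℝ) • ∑ j, dirDeriv (e j) η p • dirDeriv (e j) U p) := by
  have d0 := hη.differentiable_of_smooth
  have d1 := hU.differentiable_of_smooth
  have d2 := fun j => (contDiff_dirDeriv hη (e j)).differentiable_of_smooth
  have d3 := fun j => (contDiff_dirDeriv hU (e j)).differentiable_of_smooth
  have h2 : ∀ j, dirDeriv (e j) (dirDeriv (e j) (fun q => η q • U q)) p =
      dirDeriv (e j) (dirDeriv (e j) η) p • U p + (2 : ℝ) • (dirDeriv (e j) η p •
        dirDeriv (e j) U p) + η p • dirDeriv (e j) (dirDeriv (e j) U) p := by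
    intro j
    have h1 : dirDeriv (e j) (fun q => η q • U q) =
        fun q => dirDeriv (e j) η q • U q + η q • dirDeriv (e j) U q := by
      ext q; exact dirDeriv_smul d0 d1 _ _
    have h3 : Differentiable ℝ (fun q => dirDeriv (e j) η q • U q) := (d2 j).smul d1
    have h4 : Differentiable ℝ (fun q => η q • dirDeriv (e j) U q) := d0.smul (d3 j)
    rw [h1, dirDeriv_add h3 h4, dirDeriv_smul (d2 j) d1,
      dirDeriv_smul d0 (d3 j), two_smul]
    abel
  simp only [h2, dirDeriv_smul d0 d1, Finset.sum_add_distrib, ← Finset.smul_sum, ← Finset.sum_smul]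
  simp only [smul_add, mul_add, mul_smul_comm]
  abel

variable [FiniteDimensional ℝ G] [MeasurableSpace G] [BorelSpace G] {μ : Measure G}
  [μ.IsAddHaarMeasure] {ι : Type*} [DecidableEq ι] [Fintype ι]

/-- A Carleman inequality for the Schrödinger operator `i ∂_τ + ∑ ∂_j²`. -/
theorem carleman_complex {g : G → ℂ} (hg : IsTest g) {X w : G → ℝ}
    (hX : ContDiff ℝ ∞ X) (hw : ContDiff ℝ ∞ w) {τ : G} {e : ι → G} {i : ι} {κ α : ℝ}
    (hα : 0 ≤ α)
    (hXe : ∀ j p, dirDeriv (e j) X p = if j = i then 1 else 0) (hXτ : ∀ p, dirDeriv τ X p = 0)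
    (hwe : ∀ j p, dirDeriv (e j) w p = if j = i then 2 * α * X p else 0)
    (hwτ : ∀ p, dirDeriv τ (dirDeriv τ w) p = κ) :
    ∫ p, (64 * α ^ 3 * X p ^ 2 + 2 * κ) * (Real.exp (w p) ^ 2 * ‖g p‖ ^ 2) ∂μ ≤
    ∫ p, Real.exp (w p) ^ 2 *
      ‖Complex.I * dirDeriv τ g p + ∑ j, dirDeriv (e j) (dirDeriv (e j) g) p‖ ^ 2 ∂μ := by
  have h := carleman_real (μ := μ) hg.re hg.im hX hw hα hXe hXτ hwe hwτ
  have d0 := hg.smooth.differentiable_of_smooth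
  have dj := fun j => (hg.deriv (e j)).smooth.differentiable_of_smooth
  simp only [dirDeriv_re d0, dirDeriv_im d0, dirDeriv_re (dj _), dirDeriv_im (dj _)] at h
  simp only [Complex.sq_norm, Complex.normSq_apply]
  simp only [sq] at h ⊢
  simpa using h

/-- The Carleman inequality for a smooth function that is cut off by `η`. -/
theorem carleman_cutoff {η : G → ℝ} (hη : IsTest η) {U : G → ℂ} (hU : ContDiff ℝ ∞ U)
    {X w : G → ℝ} (hX : ContDiff ℝ ∞ X) (hw : ContDiff ℝ ∞ w) {τ : G} {e : ι → G} {i : ι}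
    {κ α M : ℝ} (hα : 0 ≤ α)
    (hXe : ∀ j p, dirDeriv (e j) X p = if j = i then 1 else 0) (hXτ : ∀ p, dirDeriv τ X p = 0)
    (hwe : ∀ j p, dirDeriv (e j) w p = if j = i then 2 * α * X p else 0)
    (hwτ : ∀ p, dirDeriv τ (dirDeriv τ w) p = κ)
    (hM : ∀ p, η p ≠ 0 → M ≤ 64 * α ^ 3 * X p ^ 2 + 2 * κ) :
    M * ∫ p, (Real.exp (w p) ^ 2 * η p ^ 2) * ‖U p‖ ^ 2 ∂μ ≤
      ∫ p, (3 * Real.exp (w p) ^ 2 * η p ^ 2) *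
          ‖Complex.I * dirDeriv τ U p + ∑ j, dirDeriv (e j) (dirDeriv (e j) U) p‖ ^ 2 ∂μ
      + ∫ p, (Real.exp (w p) ^ 2 * (3 * dirDeriv τ η p ^ 2
          + 6 * (∑ j, dirDeriv (e j) (dirDeriv (e j) η) p) ^ 2)) * ‖U p‖ ^ 2 ∂μ
      + ∑ l, ∫ p, (24 * Real.exp (w p) ^ 2 * ∑ j, dirDeriv (e j) η p ^ 2) *
          ‖dirDeriv (e l) U p‖ ^ 2 ∂μ := by
  have hE : ContDiff ℝ ∞ (fun p => Real.exp (w p)) := hw.exp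
  have cE := hE.continuous
  have cη := hη.smooth.continuous
  have cτ := (hη.deriv τ).smooth.continuous
  have cX := hX.continuous
  have cU := hU.continuous
  have cUl := fun l => (contDiff_dirDeriv hU (e l)).continuous
  have cPU : Continuous (fun p => Complex.I * dirDeriv τ U p
      + ∑ j, dirDeriv (e j) (dirDeriv (e j) U) p) :=
    (continuous_const.mul (contDiff_dirDeriv hU τ).continuous).add <|
      continuous_finsetSum _ fun j _ =>
        (contDiff_dirDeriv (contDiff_dirDeriv hU (e j)) (e j)).continuous
  have hL : IsTest (fun p => ∑ j, dirDeriv (e j) (dirDeriv (e j) η) p) :=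
    IsTest.sum _ fun j => (hη.deriv _).deriv _
  have cL := hL.smooth.continuous
  have h2 : ∀ {f : G → ℝ}, IsTest f → IsTest (fun p => f p ^ 2) := fun hf => by
    simpa only [sq] using hf.mul_left hf.smooth
  have hG : IsTest (fun p => ∑ j, dirDeriv (e j) η p ^ 2) := IsTest.sum _ fun j => h2 (hη.deriv _)
  have cG := hG.smooth.continuous
  have hint : ∀ {m : G → ℝ}, IsTest m → ∀ {f : G → ℂ}, Continuous f →
      Integrable (fun p => m p * ‖f p‖ ^ 2) μ := fun hm f hf =>
    (hm.smooth.continuous.mul (hf.norm.pow 2)).integrable_of_hasCompactSupport hm.supp.mul_right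
  have i0 : Integrable (fun p => (Real.exp (w p) ^ 2 * η p ^ 2) * ‖U p‖ ^ 2) μ :=
    hint ((h2 hη).mul_left (by fun_prop)) cU
  have i1 : Integrable (fun p => (3 * Real.exp (w p) ^ 2 * η p ^ 2) *
      ‖Complex.I * dirDeriv τ U p + ∑ j, dirDeriv (e j) (dirDeriv (e j) U) p‖ ^ 2) μ :=
    hint ((h2 hη).mul_left (by fun_prop)) cPU
  have i2 : Integrable (fun p => (Real.exp (w p) ^ 2 * (3 * dirDeriv τ η p ^ 2
          + 6 * (∑ j, dirDeriv (e j) (dirDeriv (e j) η) p) ^ 2)) * ‖U p‖ ^ 2) μ :=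
    hint ((((h2 (hη.deriv τ)).mul_left contDiff_const).add
      ((h2 hL).mul_left contDiff_const)).mul_left (by fun_prop)) cU
  have i3 : ∀ l, Integrable (fun p => (24 * Real.exp (w p) ^ 2 * ∑ j, dirDeriv (e j) η p ^ 2) *
          ‖dirDeriv (e l) U p‖ ^ 2) μ := fun l =>
    hint (hG.mul_left (by fun_prop)) (cUl l)
  have hg : IsTest (fun p => η p • U p) := hη.smul hU
  have main := carleman_complex (μ := μ) hg hX hw hα hXe hXτ hwe hwτ
  have ig : Integrable (fun p => (64 * α ^ 3 * X p ^ 2 + 2 * κ) *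
      (Real.exp (w p) ^ 2 * ‖η p • U p‖ ^ 2)) μ := by
    refine (by fun_prop : Continuous _).integrable_of_hasCompactSupport ?_
    exact HasCompactSupport.mul_left (HasCompactSupport.mul_left
      (hg.supp.comp_left (g := fun z : ℂ => ‖z‖ ^ 2) (by simp)))
  have lower : M * ∫ p, (Real.exp (w p) ^ 2 * η p ^ 2) * ‖U p‖ ^ 2 ∂μ ≤
      ∫ p, (64 * α ^ 3 * X p ^ 2 + 2 * κ) * (Real.exp (w p) ^ 2 * ‖η p • U p‖ ^ 2) ∂μ := by
    rw [← integral_const_mul]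
    refine integral_mono (i0.const_mul M) ig fun p => ?_
    simp only [norm_smul, mul_pow, Real.norm_eq_abs, sq_abs]
    rw [← mul_assoc]
    by_cases h : η p = 0
    · simp [h]
    · simpa only [mul_assoc] using mul_le_mul_of_nonneg_right (hM p h)
        (by positivity : 0 ≤ Real.exp (w p) ^ 2 * (η p ^ 2 * ‖U p‖ ^ 2))
  refine lower.trans (main.trans ?_)
  have i12 := i1.add i2
  simp only [Pi.add_def] at i12
  rw [← integral_finsetSum _ fun l _ => i3 l, ← integral_add i1 i2,
    ← integral_add i12 (integrable_finsetSum _ fun l _ => i3 l)]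
  refine integral_mono_of_nonneg (Eventually.of_forall fun p => by positivity)
    (i12.add (integrable_finsetSum _ fun l _ => i3 l)) (Eventually.of_forall fun p => ?_)
  beta_reduce
  rw [schrodinger_smul hη.smooth hU, ← Finset.mul_sum]
  generalize Complex.I * dirDeriv τ U p + ∑ j, dirDeriv (e j) (dirDeriv (e j) U) p = P
  have k1 := norm_add_three_sq_le (η p • P) (dirDeriv τ η p • (Complex.I * U p))
    ((∑ j, dirDeriv (e j) (dirDeriv (e j) η) p) • U p
        + (2 : ℝ) • ∑ j, dirDeriv (e j) η p • dirDeriv (e j) U p)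
  have k2 := norm_add_sq_le_two ((∑ j, dirDeriv (e j) (dirDeriv (e j) η) p) • U p)
        ((2 : ℝ) • ∑ j, dirDeriv (e j) η p • dirDeriv (e j) U p)
  have k3 := norm_sum_smul_sq_le (fun j => dirDeriv (e j) η p) (fun j => dirDeriv (e j) U p)
  rw [norm_smul (2 : ℝ), norm_smul _ (U p)] at k2
  rw [norm_smul (η p), norm_smul _ (Complex.I * U p), norm_mul, Complex.norm_I, one_mul] at k1
  simp only [mul_pow, Real.norm_eq_abs, sq_abs] at k1 k2
  have hEp : 0 ≤ Real.exp (w p) ^ 2 := by positivity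
  generalize ∑ j, dirDeriv (e j) (dirDeriv (e j) η) p = L at *
  -- Three summands cost a factor 3, and splitting the last one costs a further 2; the coefficient 2
  -- of the cross term, squared, makes `24 = 3 · 2 · 4`.
  calc Real.exp (w p) ^ 2 * _ ≤ Real.exp (w p) ^ 2 * (3 * (η p ^ 2 * ‖P‖ ^ 2
        + dirDeriv τ η p ^ 2 * ‖U p‖ ^ 2 + 2 * (L ^ 2 * ‖U p‖ ^ 2 + 2 ^ 2 *
        ((∑ j, dirDeriv (e j) η p ^ 2) * ∑ j, ‖dirDeriv (e j) U p‖ ^ 2)))) := by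
        gcongr
        linarith
    _ = _ := by ring

end Complex

/-! ### Mollification in `L²`. -/

section Mollify

variable {G : Type*} [NormedAddCommGroup G] [MeasurableSpace G]

/-- The convolution of `f` with the kernel `ρ`. -/
def mollify (μ : Measure G) (ρ : G → ℝ) (f : G → ℂ) (q : G) : ℂ := ∫ p, ρ (q - p) • f p ∂μ

theorem mollify_eq_convolution (μ : Measure G) (ρ : G → ℝ) (f : G → ℂ) :
    mollify μ ρ f = MeasureTheory.convolution f ρ (ContinuousLinearMap.lsmul ℝ ℝ).flip μ := by
  ext q
  simp [mollify, convolution_def]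

variable [NormedSpace ℝ G] [BorelSpace G] {μ : Measure G}

theorem contDiff_mollify {ρ : G → ℝ} (hρ : IsTest ρ) {f : G → ℂ} (hf : LocallyIntegrable f μ) :
    ContDiff ℝ ∞ (mollify μ ρ f) := by
  rw [mollify_eq_convolution]
  exact hρ.supp.contDiff_convolution_right _ hf hρ.smooth

variable [FiniteDimensional ℝ G] [μ.IsAddHaarMeasure]

theorem dirDeriv_mollify {ρ : G → ℝ} (hρ : IsTest ρ) {f : G → ℂ} (hf : LocallyIntegrable f μ)
    (v : G) : dirDeriv v (mollify μ ρ f) = mollify μ (dirDeriv v ρ) f := by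
  ext q
  have h := hρ.supp.hasFDerivAt_convolution_right (ContinuousLinearMap.lsmul ℝ ℝ).flip (μ := μ) hf
    (hρ.smooth.of_le (by simp)) q
  rw [mollify_eq_convolution, mollify_eq_convolution, dirDeriv, h.fderiv]
  exact convolution_precompR_apply _ hf (hρ.supp.fderiv (𝕜 := ℝ))
    (hρ.smooth.continuous_fderiv (by simp)) _ _

/-- Continuity of translations in `L²`, read off from the continuous action of the additive group on
`Lp`. -/
theorem exists_eLpNorm_translate_sub_le {f : G → ℂ} (hf : MemLp f 2 μ) {ε : ENNReal} (hε : ε ≠ 0) :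
    ∃ r > 0, ∀ h : G, ‖h‖ < r → eLpNorm (fun x => f (x - h) - f x) 2 μ ≤ ε := by
  have : Fact ((2 : ENNReal) ≠ ⊤) := ⟨by simp⟩
  have hc : Continuous fun h : G => (DomAddAct.mk (-h)) +ᵥ hf.toLp f :=
    (DomAddAct.continuous_mk.comp continuous_neg).vadd continuous_const
  have h0 : (DomAddAct.mk (-(0 : G))) +ᵥ hf.toLp f = hf.toLp f := by simp
  have ht := hc.tendsto 0
  rw [h0, EMetric.tendsto_nhds] at ht
  obtain ⟨r, hr, H⟩ := Metric.eventually_nhds_iff.1 (ht ε (pos_iff_ne_zero.2 hε))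
  refine ⟨r, hr, fun h hh => ?_⟩
  have h1 := (H (y := h) (by simpa using hh)).le
  rw [DomAddAct.mk_vadd_toLp, Lp.edist_toLp_toLp] at h1
  have h2 : (fun x => f (x - h) - f x) = (fun x => f (-h +ᵥ x)) - f := by
    funext x
    simp [sub_eq_neg_add]
  rwa [h2]

theorem enorm_integral_sq_le {α : Type*} [MeasurableSpace α] {ν : Measure α}
    [IsProbabilityMeasure ν] {g : α → ℂ} (hg : AEStronglyMeasurable g ν) :
    ‖∫ a, g a ∂ν‖ₑ ^ (2 : ℝ) ≤ ∫⁻ a, ‖g a‖ₑ ^ (2 : ℝ) ∂ν := by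
  have h1 := eLpNorm_le_eLpNorm_of_exponent_le (p := 1) (q := 2) (by norm_num) hg
  rw [eLpNorm_one_eq_lintegral_enorm,
    eLpNorm_eq_lintegral_rpow_enorm_toReal (by simp) (by simp)] at h1
  have h2 := (enorm_integral_le_lintegral_enorm g).trans h1
  calc ‖∫ a, g a ∂ν‖ₑ ^ (2 : ℝ) ≤ _ := ENNReal.rpow_le_rpow h2 (by norm_num)
    _ = _ := by
      rw [← ENNReal.rpow_mul]
      simp

/-- The mollification is an average of translates of `f` by vectors shorter than `r`; Jensen's
inequality for the square and Tonelli bound its error by that of the translates. -/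
theorem eLpNorm_mollify_sub_le {f : G → ℂ} (hf : MemLp f 2 μ) {ε : ENNReal} {r : ℝ}
    (hr : ∀ h : G, ‖h‖ < r → eLpNorm (fun x => f (x - h) - f x) 2 μ ≤ ε)
    (φ : ContDiffBump (0 : G)) (hφ : φ.rOut ≤ r) :
    eLpNorm (fun q => mollify μ (φ.normed μ) f q - f q) 2 μ ≤ ε := by
  -- Tonelli needs `(q, h) ↦ f (q - h) - f q` to be jointly measurable, so `f` is replaced by a
  -- strongly measurable representative.
  wlog hsm : StronglyMeasurable f generalizing f
  · have hae := hf.1.ae_eq_mk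
    have h1 : mollify μ (φ.normed μ) f = mollify μ (φ.normed μ) (hf.1.mk f) := by
      ext q
      refine integral_congr_ae ?_
      filter_upwards [hae] with p hp
      rw [hp]
    have h2 : eLpNorm (fun q => mollify μ (φ.normed μ) f q - f q) 2 μ =
        eLpNorm (fun q => mollify μ (φ.normed μ) (hf.1.mk f) q - hf.1.mk f q) 2 μ := by
      refine eLpNorm_congr_ae ?_
      filter_upwards [hae] with q hq
      rw [h1, hq]
    rw [h2]
    refine this (hf.ae_eq hae) (fun h hh => ?_) hf.1.stronglyMeasurable_mk
    refine (le_of_eq (eLpNorm_congr_ae ?_)).trans (hr h hh)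
    have h3 := (measurePreserving_sub_right μ h).quasiMeasurePreserving.ae_eq_comp hae
    filter_upwards [hae, h3] with x hx hx'
    simp only [Function.comp] at hx'
    rw [hx, hx']
  have hmeas : Measurable fun h => ENNReal.ofReal (φ.normed μ h) :=
    (φ.continuous_normed.measurable).ennreal_ofReal
  set ν := μ.withDensity fun h => ENNReal.ofReal (φ.normed μ h) with hν
  have : IsProbabilityMeasure ν := by
    refine ⟨?_⟩
    rw [hν, withDensity_apply _ MeasurableSet.univ, Measure.restrict_univ,
      ← ofReal_integral_eq_lintegral_ofReal φ.integrable_normed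
        (Eventually.of_forall φ.nonneg_normed), φ.integral_normed, ENNReal.ofReal_one]
  have hνball : ∀ᵐ h ∂ν, ‖h‖ < r := by
    rw [hν, ae_withDensity_iff hmeas]
    refine Eventually.of_forall fun h hh => ?_
    have : h ∈ Function.support (φ.normed μ) := fun h0 => hh (by simp [h0])
    rw [φ.support_normed_eq] at this
    exact (by simpa using this : ‖h‖ < φ.rOut).trans_le hφ
  have hloc : LocallyIntegrable f μ := hf.locallyIntegrable (by norm_num)
  have hint : ∀ q, Integrable (fun h => φ.normed μ h • f (q - h)) μ := by
    intro q
    have : Integrable (fun p => φ.normed μ (q - p) • f p) μ := by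
      refine hloc.integrable_smul_left_of_hasCompactSupport
        (φ.continuous_normed.comp (continuous_const.sub continuous_id)) ?_
      exact φ.hasCompactSupport_normed.comp_homeomorph (Homeomorph.subLeft q)
    simpa using this.comp_sub_left q
  have hrep : ∀ q, mollify μ (φ.normed μ) f q - f q = ∫ h, (f (q - h) - f q) ∂ν := by
    intro q
    have h1 : mollify μ (φ.normed μ) f q = ∫ h, φ.normed μ h • f (q - h) ∂μ := by
      rw [mollify, ← integral_sub_left_eq_self _ μ q]
      simp
    rw [hν, integral_withDensity_eq_integral_toReal_smul hmeas (by simp)]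
    simp only [ENNReal.toReal_ofReal (φ.nonneg_normed _), smul_sub]
    rw [integral_sub (hint q) (φ.integrable_normed.smul_const _), integral_smul_const,
      φ.integral_normed, one_smul, h1]
  have hm2 : StronglyMeasurable (Function.uncurry fun q h => f (q - h) - f q) :=
    (hsm.comp_measurable (measurable_fst.sub measurable_snd)).sub (hsm.comp_measurable measurable_fst)
  rw [eLpNorm_eq_lintegral_rpow_enorm_toReal (by simp) (by simp)]
  simp only [ENNReal.toReal_ofNat, hrep]
  rw [one_div, ENNReal.rpow_inv_le_iff (by norm_num)]
  calc ∫⁻ q, ‖∫ h, (f (q - h) - f q) ∂ν‖ₑ ^ (2 : ℝ) ∂μ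
      ≤ ∫⁻ q, ∫⁻ h, ‖f (q - h) - f q‖ₑ ^ (2 : ℝ) ∂ν ∂μ :=
        lintegral_mono fun q => enorm_integral_sq_le
          (hm2.comp_measurable measurable_prodMk_left).aestronglyMeasurable
    _ = ∫⁻ h, ∫⁻ q, ‖f (q - h) - f q‖ₑ ^ (2 : ℝ) ∂μ ∂ν :=
        lintegral_lintegral_swap (hm2.enorm.pow_const _).aemeasurable
    _ ≤ ∫⁻ _, ε ^ (2 : ℝ) ∂ν := by
        refine lintegral_mono_ae ?_
        filter_upwards [hνball] with h hh
        have := hr h hh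
        rw [eLpNorm_eq_lintegral_rpow_enorm_toReal (by simp) (by simp)] at this
        simp only [ENNReal.toReal_ofNat] at this
        rwa [one_div, ENNReal.rpow_inv_le_iff (by norm_num)] at this
    _ = ε ^ (2 : ℝ) := by simp

theorem memLp_mollify {f : G → ℂ} (hf : MemLp f 2 μ) (φ : ContDiffBump (0 : G)) :
    MemLp (mollify μ (φ.normed μ) f) 2 μ := by
  have hcont : Continuous (mollify μ (φ.normed μ) f) :=
    (contDiff_mollify ⟨φ.contDiff_normed, φ.hasCompactSupport_normed⟩
      (hf.locallyIntegrable (by norm_num))).continuous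
  have h1 : MemLp (fun q => mollify μ (φ.normed μ) f q - f q) 2 μ := by
    refine ⟨hcont.aestronglyMeasurable.sub hf.1, ?_⟩
    -- Only finiteness matters here: a translate differs from `f` by at most twice the norm of `f`.
    refine (eLpNorm_mollify_sub_le hf (ε := eLpNorm f 2 μ + eLpNorm f 2 μ) (r := φ.rOut)
      (fun h _ => ?_) φ le_rfl).trans_lt (ENNReal.add_lt_top.2 ⟨hf.2, hf.2⟩)
    have hp := measurePreserving_sub_right μ h
    have h2 := eLpNorm_comp_measurePreserving (p := 2) hf.1 hp
    have h3 := eLpNorm_sub_le (hf.comp_measurePreserving hp).1 hf.1 (p := 2) (by norm_num)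
    rw [h2] at h3
    exact h3
  have h2 := h1.add hf
  simp only [Pi.add_def, sub_add_cancel] at h2
  exact h2

theorem tendsto_eLpNorm_mollify_sub {f : G → ℂ} (hf : MemLp f 2 μ)
    {φ : ℕ → ContDiffBump (0 : G)} (hφ : Tendsto (fun k => (φ k).rOut) atTop (𝓝 0)) :
    Tendsto (fun k => eLpNorm (fun q => mollify μ ((φ k).normed μ) f q - f q) 2 μ)
      atTop (𝓝 0) := by
  rw [ENNReal.tendsto_nhds_zero]
  intro ε hε
  obtain ⟨r, hr, H⟩ := exists_eLpNorm_translate_sub_le hf hε.ne'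
  filter_upwards [hφ.eventually (gt_mem_nhds hr)] with k hk
  exact eLpNorm_mollify_sub_le hf H (φ k) hk.le

end Mollify

/-! ### Weighted square integrals under `L²` convergence. -/

section Limits

variable {α : Type*} [MeasurableSpace α] {μ : Measure α}

theorem eLpNorm_two_toReal_sq {f : α → ℂ} (hf : MemLp f 2 μ) :
    (eLpNorm f 2 μ).toReal ^ 2 = ∫ a, ‖f a‖ ^ 2 ∂μ := by
  rw [hf.eLpNorm_eq_integral_rpow_norm (by simp) (by simp), ENNReal.toReal_ofReal (by positivity)]
  simp only [ENNReal.toReal_ofNat, Real.rpow_two]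
  rw [← Real.rpow_natCast, ← Real.rpow_mul (by positivity)]
  simp

/-- Convergence in `L²` implies convergence of weighted square integrals, for bounded weights. -/
theorem tendsto_integral_weight_mul_sq {f : α → ℂ} {F : ℕ → α → ℂ} (hf : MemLp f 2 μ)
    (hF : ∀ k, MemLp (F k) 2 μ)
    (h : Tendsto (fun k => eLpNorm (fun a => F k a - f a) 2 μ) atTop (𝓝 0))
    {m : α → ℝ} (hm : Measurable m) (hm0 : ∀ a, 0 ≤ m a) {C : ℝ} (hmC : ∀ a, m a ≤ C) :
    Tendsto (fun k => ∫ a, m a * ‖F k a‖ ^ 2 ∂μ) atTop (𝓝 (∫ a, m a * ‖f a‖ ^ 2 ∂μ)) := by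
  -- Moving the weight into the measure turns the claim into continuity of the norm of `L²(ν)`, and
  -- `ν ≤ C μ` transfers the convergence.
  set ν := μ.withDensity fun a => ENNReal.ofReal (m a) with hν
  have hle : ν ≤ ENNReal.ofReal C • μ := by
    rw [hν, ← withDensity_const]
    exact withDensity_mono (Eventually.of_forall fun a => ENNReal.ofReal_le_ofReal (hmC a))
  have hmem : ∀ {g : α → ℂ}, MemLp g 2 μ → MemLp g 2 ν := fun hg =>
    (hg.smul_measure (c := ENNReal.ofReal C) (by simp)).mono_measure hle
  have hrep : ∀ g : α → ℂ, ∫ a, m a * ‖g a‖ ^ 2 ∂μ = ∫ a, ‖g a‖ ^ 2 ∂ν := by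
    intro g
    rw [hν, integral_withDensity_eq_integral_toReal_smul hm.ennreal_ofReal (by simp)]
    simp [ENNReal.toReal_ofReal (hm0 _)]
  have hν0 : Tendsto (fun k => eLpNorm (F k - f) 2 ν) atTop (𝓝 0) := by
    have h1 : Tendsto (fun k => ENNReal.ofReal C ^ (1 / (2 : ENNReal)).toReal *
        eLpNorm (fun a => F k a - f a) 2 μ) atTop (𝓝 0) := by
      simpa using ENNReal.Tendsto.const_mul h (Or.inr (by simp))
    refine tendsto_of_tendsto_of_tendsto_of_le_of_le tendsto_const_nhds h1 (fun k => zero_le)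
      fun k => ?_
    refine (eLpNorm_mono_measure _ hle).trans (le_of_eq ?_)
    rw [eLpNorm_smul_measure_of_ne_top (by simp)]
    rfl
  have hlp := (Lp.tendsto_Lp_iff_tendsto_eLpNorm'' F (fun k => hmem (hF k)) f (hmem hf)).2 hν0
  have hn := (hlp.norm).pow 2
  simp only [Lp.norm_toLp, eLpNorm_two_toReal_sq (hmem hf), eLpNorm_two_toReal_sq (hmem (hF _))]
    at hn
  simpa only [hrep] using hn

end Limits

/-! ### The Carleman inequality for weak solutions. -/

section WeakCarleman

variable {G : Type*} [NormedAddCommGroup G] [NormedSpace ℝ G] [FiniteDimensional ℝ G]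
  [MeasurableSpace G] [BorelSpace G] {μ : Measure G} [μ.IsAddHaarMeasure]
  {ι : Type*} [DecidableEq ι] [Fintype ι]

theorem tendsto_integral_weight_mollify {f : G → ℂ} (hf : MemLp f 2 μ)
    {φ : ℕ → ContDiffBump (0 : G)} (hφ : Tendsto (fun k => (φ k).rOut) atTop (𝓝 0))
    {m : G → ℝ} (hm : IsTest m) (hm0 : ∀ p, 0 ≤ m p) :
    Tendsto (fun k => ∫ p, m p * ‖mollify μ ((φ k).normed μ) f p‖ ^ 2 ∂μ) atTop
      (𝓝 (∫ p, m p * ‖f p‖ ^ 2 ∂μ)) := by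
  obtain ⟨C, hC⟩ := hm.smooth.continuous.bounded_above_of_compact_support hm.supp
  exact tendsto_integral_weight_mul_sq hf (fun k => memLp_mollify hf (φ k))
    (tendsto_eLpNorm_mollify_sub hf hφ) hm.smooth.continuous.measurable hm0
    (fun p => (le_abs_self _).trans (hC p))

/-- The Carleman inequality for a cut-off weak solution `U` with gradient `D`; derivatives of `U`
enter through its convolutions with test functions. -/
theorem carleman_weak {η : G → ℝ} (hη : IsTest η) {U F : G → ℂ} {D : ι → G → ℂ}
    (hU : MemLp U 2 μ) (hF : MemLp F 2 μ) (hD : ∀ l, MemLp (D l) 2 μ)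
    {X w : G → ℝ} (hX : ContDiff ℝ ∞ X) (hw : ContDiff ℝ ∞ w) {τ : G} {e : ι → G} {i : ι}
    {κ α M : ℝ} (hα : 0 ≤ α)
    (hXe : ∀ j p, dirDeriv (e j) X p = if j = i then 1 else 0) (hXτ : ∀ p, dirDeriv τ X p = 0)
    (hwe : ∀ j p, dirDeriv (e j) w p = if j = i then 2 * α * X p else 0)
    (hwτ : ∀ p, dirDeriv τ (dirDeriv τ w) p = κ)
    (hM : ∀ p, η p ≠ 0 → M ≤ 64 * α ^ 3 * X p ^ 2 + 2 * κ)
    (hgrad : ∀ ρ, IsTest ρ → ∀ l q, mollify μ (dirDeriv (e l) ρ) U q = mollify μ ρ (D l) q)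
    {r : ℝ} (hr : 0 < r)
    (heq : ∀ ρ, IsTest ρ → Function.support ρ ⊆ Metric.ball 0 r → ∀ q, η q ≠ 0 →
      Complex.I * mollify μ (dirDeriv τ ρ) U q
        + ∑ j, mollify μ (dirDeriv (e j) (dirDeriv (e j) ρ)) U q = mollify μ ρ F q) :
    M * ∫ p, (Real.exp (w p) ^ 2 * η p ^ 2) * ‖U p‖ ^ 2 ∂μ ≤
      ∫ p, (3 * Real.exp (w p) ^ 2 * η p ^ 2) * ‖F p‖ ^ 2 ∂μ
      + ∫ p, (Real.exp (w p) ^ 2 * (3 * dirDeriv τ η p ^ 2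
          + 6 * (∑ j, dirDeriv (e j) (dirDeriv (e j) η) p) ^ 2)) * ‖U p‖ ^ 2 ∂μ
      + ∑ l, ∫ p, (24 * Real.exp (w p) ^ 2 * ∑ j, dirDeriv (e j) η p ^ 2) *
          ‖D l p‖ ^ 2 ∂μ := by
  let φ : ℕ → ContDiffBump (0 : G) := fun k =>
    ⟨r / (k + 1) / 2, r / (k + 1), by positivity, half_lt_self (by positivity)⟩
  have hφ : Tendsto (fun k => (φ k).rOut) atTop (𝓝 0) := by
    simpa [φ, div_eq_mul_inv] using
      (tendsto_one_div_add_atTop_nhds_zero_nat (𝕜 := ℝ)).const_mul r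
  have hφr : ∀ k, (φ k).rOut ≤ r := fun k =>
    div_le_self hr.le (by linarith [(Nat.cast_nonneg k : (0 : ℝ) ≤ k)])
  have hρ : ∀ k, IsTest ((φ k).normed μ) := fun k =>
    ⟨(φ k).contDiff_normed, (φ k).hasCompactSupport_normed⟩
  have hUl : LocallyIntegrable U μ := hU.locallyIntegrable (by norm_num)
  have hE : ContDiff ℝ ∞ (fun p => Real.exp (w p)) := hw.exp
  have h2 : ∀ {f : G → ℝ}, IsTest f → IsTest (fun p => f p ^ 2) := fun hf => by
    simpa only [sq] using hf.mul_left hf.smooth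
  have hL : IsTest (fun p => ∑ j, dirDeriv (e j) (dirDeriv (e j) η) p) :=
    IsTest.sum _ fun j => (hη.deriv _).deriv _
  have hG : IsTest (fun p => ∑ j, dirDeriv (e j) η p ^ 2) := IsTest.sum _ fun j => h2 (hη.deriv _)
  have t0 := (tendsto_integral_weight_mollify hU hφ
    ((h2 hη).mul_left (by fun_prop : ContDiff ℝ ∞ (fun p => Real.exp (w p) ^ 2)))
    (fun p => by positivity)).const_mul M
  have t1 := tendsto_integral_weight_mollify hF hφ
    ((h2 hη).mul_left (by fun_prop : ContDiff ℝ ∞ (fun p => 3 * Real.exp (w p) ^ 2)))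
    (fun p => by positivity)
  have t2 := tendsto_integral_weight_mollify hU hφ
    ((((h2 (hη.deriv τ)).mul_left (contDiff_const (c := 3))).add
      ((h2 hL).mul_left (contDiff_const (c := 6)))).mul_left
        (by fun_prop : ContDiff ℝ ∞ (fun p => Real.exp (w p) ^ 2)))
    (fun p => by positivity)
  have t3 := tendsto_finsetSum Finset.univ fun l _ => tendsto_integral_weight_mollify (hD l) hφ
    (hG.mul_left (by fun_prop : ContDiff ℝ ∞ (fun p => 24 * Real.exp (w p) ^ 2)))
    (fun p => by positivity)
  refine le_of_tendsto_of_tendsto' t0 ((t1.add t2).add t3) fun k => ?_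
  have main := carleman_cutoff (μ := μ) hη (contDiff_mollify (hρ k) hUl) hX hw hα hXe hXτ hwe hwτ hM
  have e1 : ∀ l, dirDeriv (e l) (mollify μ ((φ k).normed μ) U) =
      mollify μ ((φ k).normed μ) (D l) := fun l => by
    rw [dirDeriv_mollify (hρ k) hUl]
    ext q
    exact hgrad _ (hρ k) l q
  refine main.trans (le_of_eq ?_)
  congr 1
  · congr 1
    congr 1
    ext p
    -- The mollified equation is known only where `η` does not vanish, and nothing more is needed
    -- since this term carries the factor `η²`.
    by_cases hp : η p = 0
    · simp [hp]
    · rw [← heq _ (hρ k) ?_ p hp]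
      · simp only [dirDeriv_mollify (hρ k) hUl, dirDeriv_mollify ((hρ k).deriv _) hUl]
      · rw [(φ k).support_normed_eq]
        exact Metric.ball_subset_ball (hφr k)
  · simp only [e1]

end WeakCarleman

/-! ### Cutoff functions with derivative bounds uniform in `R`. -/

section Cutoff

theorem exists_smooth_step : ∃ s : ℝ → ℝ, ContDiff ℝ ∞ s ∧ (∀ y ≤ 0, s y = 0) ∧
    (∀ y, 1 ≤ y → s y = 1) ∧ (∀ y, deriv s y ≠ 0 → 0 < y ∧ y < 1) ∧
    (∀ y, deriv (deriv s) y ≠ 0 → 0 < y ∧ y < 1) ∧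
    ∃ K, 0 ≤ K ∧ ∀ y, |s y| ≤ K ∧ |deriv s y| ≤ K ∧ |deriv (deriv s) y| ≤ K := by
  -- Squeezing the transition into `[1/3, 2/3]` keeps the closed supports of both derivatives inside
  -- the open interval `(0, 1)`, which yields the strict inequalities.
  let s : ℝ → ℝ := fun y => Real.smoothTransition (3 * y - 1)
  have hs : ContDiff ℝ ∞ s := Real.smoothTransition.contDiff.comp (by fun_prop)
  have h0 : ∀ y, y < 1 / 3 → s y = 0 := fun y hy =>
    Real.smoothTransition.zero_of_nonpos (by linarith)
  have h1 : ∀ y, 2 / 3 < y → s y = 1 := fun y hy =>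
    Real.smoothTransition.one_of_one_le (by linarith)
  have hd : ∀ y, deriv s y ≠ 0 → y ∈ Set.Icc (1 / 3 : ℝ) (2 / 3) := by
    intro y hy
    by_contra hmem
    apply hy
    rcases not_and_or.1 hmem with h | h
    · have : s =ᶠ[𝓝 y] fun _ => 0 := by
        filter_upwards [gt_mem_nhds (not_le.1 h)] with z hz using h0 z hz
      rw [this.deriv_eq, deriv_const]
    · have : s =ᶠ[𝓝 y] fun _ => 1 := by
        filter_upwards [lt_mem_nhds (not_le.1 h)] with z hz using h1 z hz
      rw [this.deriv_eq, deriv_const]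
  have hts : tsupport (deriv s) ⊆ Set.Icc (1 / 3 : ℝ) (2 / 3) :=
    closure_minimal (fun y hy => hd y hy) isClosed_Icc
  have hdd : ∀ y, deriv (deriv s) y ≠ 0 → y ∈ Set.Icc (1 / 3 : ℝ) (2 / 3) := fun y hy =>
    hts (support_deriv_subset hy)
  have cs1 : HasCompactSupport (deriv s) :=
    HasCompactSupport.of_support_subset_isCompact isCompact_Icc hd
  have cs2 : HasCompactSupport (deriv (deriv s)) :=
    HasCompactSupport.of_support_subset_isCompact isCompact_Icc hdd
  have hs1 : ContDiff ℝ ∞ (deriv s) := (contDiff_infty_iff_deriv.1 hs).2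
  have hs2 : ContDiff ℝ ∞ (deriv (deriv s)) := (contDiff_infty_iff_deriv.1 hs1).2
  obtain ⟨K1, hK1⟩ := hs1.continuous.bounded_above_of_compact_support cs1
  obtain ⟨K2, hK2⟩ := hs2.continuous.bounded_above_of_compact_support cs2
  refine ⟨s, hs, fun y hy => h0 y (by linarith), fun y hy => h1 y (by linarith), ?_, ?_,
    max 1 (max K1 K2), by positivity, fun y => ⟨?_, ?_, ?_⟩⟩
  · exact fun y hy => ⟨by linarith [(hd y hy).1], by linarith [(hd y hy).2]⟩
  · exact fun y hy => ⟨by linarith [(hdd y hy).1], by linarith [(hdd y hy).2]⟩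
  · rw [abs_of_nonneg (Real.smoothTransition.nonneg _)]
    exact (Real.smoothTransition.le_one _).trans (le_max_left _ _)
  · exact (hK1 y).trans ((le_max_left _ _).trans (le_max_right _ _))
  · exact (hK2 y).trans ((le_max_right _ _).trans (le_max_right _ _))

theorem exists_time_cutoff : ∃ χ : ℝ → ℝ, ContDiff ℝ ∞ χ ∧ (∀ t, |t - 1 / 2| ≤ 3 / 8 → χ t = 1) ∧
    (∀ t, χ t ≠ 0 → |t - 1 / 2| < 7 / 16) ∧ (∀ t, deriv χ t ≠ 0 → 3 / 8 ≤ |t - 1 / 2|) ∧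
    ∃ K, 0 ≤ K ∧ ∀ t, |χ t| ≤ 1 ∧ |deriv χ t| ≤ K := by
  let χ : ContDiffBump (1 / 2 : ℝ) := ⟨3 / 8, 7 / 16, by norm_num, by norm_num⟩
  have hd : ContDiff ℝ ∞ (deriv χ) := (contDiff_infty_iff_deriv.1 χ.contDiff).2
  obtain ⟨K, hK⟩ := hd.continuous.bounded_above_of_compact_support χ.hasCompactSupport.deriv
  refine ⟨χ, χ.contDiff, fun t ht => χ.one_of_mem_closedBall ?_, fun t ht => ?_, fun t ht => ?_,
    K, (norm_nonneg _).trans (hK 0), fun t => ⟨?_, hK t⟩⟩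
  · simpa [Real.dist_eq] using ht
  · by_contra h
    exact ht (χ.zero_of_le_dist (by simpa [Real.dist_eq] using h))
  · by_contra h
    apply ht
    have : t ∈ Metric.ball (1 / 2 : ℝ) χ.rIn := by
      simpa [Real.dist_eq, χ] using h
    rw [(χ.eventuallyEq_one_of_mem_ball this).deriv_eq]
    exact deriv_const _ _
  · rw [abs_of_nonneg χ.nonneg]
    exact χ.le_one

theorem dirDeriv_comp {G : Type*} [NormedAddCommGroup G] [NormedSpace ℝ G] {s : ℝ → ℝ} {f : G → ℝ}
    (hs : Differentiable ℝ s) (hf : Differentiable ℝ f) (v p : G) :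
    dirDeriv v (fun q => s (f q)) p = deriv s (f p) * dirDeriv v f p := by
  have := ((hs (f p)).hasDerivAt.comp_hasFDerivAt p (hf p).hasFDerivAt).fderiv
  simp only [dirDeriv]
  change fderiv ℝ (s ∘ f) p v = _
  rw [this]
  simp

variable {n : ℕ}

/-- The time direction in space-time. -/
def timeDir (n : ℕ) : ℝ × EuclideanSpace ℝ (Fin n) := (1, 0)

/-- The `j`-th space direction in space-time. -/
def spaceDir (j : Fin n) : ℝ × EuclideanSpace ℝ (Fin n) := (0, EuclideanSpace.single j 1)

theorem dirDeriv_fst (v p : ℝ × EuclideanSpace ℝ (Fin n)) :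
    dirDeriv v (fun q : ℝ × EuclideanSpace ℝ (Fin n) => q.1) p = v.1 := by
  simp only [dirDeriv]
  rw [fderiv_fst]
  rfl

theorem dirDeriv_coord (i : Fin n) (v p : ℝ × EuclideanSpace ℝ (Fin n)) :
    dirDeriv v (fun q : ℝ × EuclideanSpace ℝ (Fin n) => q.2 i) p = v.2 i := by
  have h := (((EuclideanSpace.proj (𝕜 := ℝ) i).comp
    (ContinuousLinearMap.snd ℝ ℝ (EuclideanSpace ℝ (Fin n)))).hasFDerivAt (x := p)).fderiv
  simp only [dirDeriv]
  change fderiv ℝ (⇑((EuclideanSpace.proj (𝕜 := ℝ) i).comp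
    (ContinuousLinearMap.snd ℝ ℝ (EuclideanSpace ℝ (Fin n))))) p v = _
  rw [h]
  rfl

theorem contDiff_coord (i : Fin n) :
    ContDiff ℝ ∞ (fun q : ℝ × EuclideanSpace ℝ (Fin n) => q.2 i) :=
  ((EuclideanSpace.proj (𝕜 := ℝ) i).comp
    (ContinuousLinearMap.snd ℝ ℝ (EuclideanSpace ℝ (Fin n)))).contDiff

theorem contDiff_norm_snd_sq :
    ContDiff ℝ ∞ (fun q : ℝ × EuclideanSpace ℝ (Fin n) => ‖q.2‖ ^ 2) :=
  contDiff_snd.norm_sq ℝ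

theorem dirDeriv_norm_snd_sq (v p : ℝ × EuclideanSpace ℝ (Fin n)) :
    dirDeriv v (fun q : ℝ × EuclideanSpace ℝ (Fin n) => ‖q.2‖ ^ 2) p = 2 * ⟪p.2, v.2⟫_ℝ := by
  have h := ((hasFDerivAt_snd (𝕜 := ℝ) (p := p)).norm_sq).fderiv
  simp only [dirDeriv]
  rw [h]
  simp

/-- A smooth cutoff in space-time: equal to one for `|t - 1/2| ≤ 3/8`, `|x| ≤ R - 1`, and to zero
outside `|t - 1/2| < 7/16`, `|x| < R`, with derivatives bounded uniformly in `R`. -/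
theorem exists_spacetime_cutoff (n : ℕ) : ∃ K : ℝ, 0 < K ∧ ∀ R : ℝ, 1 ≤ R →
    ∃ η : ℝ × EuclideanSpace ℝ (Fin n) → ℝ, IsTest η ∧
      (∀ p, η p ≠ 0 → |p.1 - 1 / 2| < 7 / 16 ∧ ‖p.2‖ < R) ∧
      (∀ p, |p.1 - 1 / 2| ≤ 3 / 8 → ‖p.2‖ ≤ R - 1 → η p = 1) ∧
      (∀ p, dirDeriv (timeDir n) η p ^ 2 ≤ K) ∧
      (∀ p, dirDeriv (timeDir n) η p ≠ 0 → 3 / 8 ≤ |p.1 - 1 / 2| ∧ ‖p.2‖ < R) ∧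
      (∀ p, (∑ j, dirDeriv (spaceDir j) (dirDeriv (spaceDir j) η) p) ^ 2 ≤ K) ∧
      (∀ p, ∑ j, dirDeriv (spaceDir j) η p ^ 2 ≤ K) ∧
      (∀ p, ¬ (R - 1 < ‖p.2‖ ∧ ‖p.2‖ < R) →
        ∑ j, dirDeriv (spaceDir j) (dirDeriv (spaceDir j) η) p = 0 ∧
        ∑ j, dirDeriv (spaceDir j) η p ^ 2 = 0) := by
  obtain ⟨s, hs, s0, s1, ds, dds, K, hK0, hK⟩ := exists_smooth_step
  obtain ⟨χ, hχ, χ1, χ0, dχ, K', hK'0, hK'⟩ := exists_time_cutoff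
  have hds : ContDiff ℝ ∞ (deriv s) := (contDiff_infty_iff_deriv.1 hs).2
  have dds' := hds.differentiable_of_smooth
  have ds' := hs.differentiable_of_smooth
  have dχ' := hχ.differentiable_of_smooth
  refine ⟨1 + (K' * K) ^ 2 + (n * (6 * K)) ^ 2 + n * (2 * K) ^ 2, by positivity, fun R hR => ?_⟩
  have hc : 0 < 2 * R - 1 := by linarith
  -- Since `R² - (R-1)² = 2R - 1`, `m` is `0` on `|x| = R` and `1` on `|x| = R - 1`. Being quadratic
  -- in `x` it is smooth at the origin too, and its gradient components `-2x_j/(2R-1)` stay bounded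
  -- by 2 on `|x| < R`, uniformly in `R ≥ 1`.
  let m : ℝ × EuclideanSpace ℝ (Fin n) → ℝ := fun p => (R ^ 2 - ‖p.2‖ ^ 2) * (2 * R - 1)⁻¹
  have hN := contDiff_norm_snd_sq (n := n)
  have dN := hN.differentiable_of_smooth
  have hm : ContDiff ℝ ∞ m := (contDiff_const.sub hN).mul contDiff_const
  have dm := hm.differentiable_of_smooth
  have mval : ∀ p, m p * (2 * R - 1) = R ^ 2 - ‖p.2‖ ^ 2 := fun p => by
    exact inv_mul_cancel_right₀ hc.ne' _
  have m0 : ∀ p, 0 < m p → ‖p.2‖ < R := by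
    intro p hp
    have h1 := mul_pos hp hc
    rw [mval] at h1
    exact lt_of_pow_lt_pow_left₀ 2 (by linarith) (by linarith)
  have m1 : ∀ p, m p < 1 → R - 1 < ‖p.2‖ := by
    intro p hp
    have h1 := mul_lt_mul_of_pos_right hp hc
    rw [mval] at h1
    exact lt_of_pow_lt_pow_left₀ 2 (norm_nonneg _) (by nlinarith)
  have m1' : ∀ p, ‖p.2‖ ≤ R - 1 → 1 ≤ m p := by
    intro p hp
    by_contra h
    exact absurd (m1 p (not_le.1 h)) (not_lt.2 hp)
  have dmτ : ∀ p, dirDeriv (timeDir n) m p = 0 := by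
    intro p
    simp (disch := fun_prop) only [m, dirDeriv_mul, dirDeriv_sub, dirDeriv_const,
      dirDeriv_norm_snd_sq]
    simp [timeDir]
  have dmj : ∀ (j : Fin n), dirDeriv (spaceDir j) m = fun p => (-2 * (2 * R - 1)⁻¹) * p.2 j := by
    intro j
    ext p
    simp (disch := fun_prop) only [m, dirDeriv_mul, dirDeriv_sub, dirDeriv_const,
      dirDeriv_norm_snd_sq]
    simp [spaceDir, EuclideanSpace.inner_single_right]
    ring
  have hf : ContDiff ℝ ∞ (fun p : ℝ × EuclideanSpace ℝ (Fin n) => χ p.1) := hχ.comp contDiff_fst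
  have df := hf.differentiable_of_smooth
  have hsm : ContDiff ℝ ∞ (fun p => s (m p)) := hs.comp hm
  have dsm := hsm.differentiable_of_smooth
  have hdsm : ContDiff ℝ ∞ (fun p => deriv s (m p)) := hds.comp hm
  have ddsm := hdsm.differentiable_of_smooth
  have dfst : Differentiable ℝ (fun q : ℝ × EuclideanSpace ℝ (Fin n) => q.1) := by fun_prop
  have dfv : ∀ v p : ℝ × EuclideanSpace ℝ (Fin n), dirDeriv v (fun p => χ p.1) p =
      deriv χ p.1 * v.1 := fun v p => by
    rw [dirDeriv_comp dχ' dfst, dirDeriv_fst]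
  have dητ : ∀ p, dirDeriv (timeDir n) (fun p => χ p.1 * s (m p)) p = deriv χ p.1 * s (m p) := by
    intro p
    rw [dirDeriv_mul df dsm, dfv, dirDeriv_comp ds' dm, dmτ]
    simp [timeDir]
  have dηj : ∀ j : Fin n, dirDeriv (spaceDir j) (fun p => χ p.1 * s (m p)) =
      fun p => (χ p.1 * deriv s (m p)) * ((-2 * (2 * R - 1)⁻¹) * p.2 j) := by
    intro j
    ext p
    rw [dirDeriv_mul df dsm, dfv, dirDeriv_comp ds' dm, dmj]
    simp [spaceDir]
    ring
  have dηjj : ∀ (j : Fin n) p,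
      dirDeriv (spaceDir j) (dirDeriv (spaceDir j) (fun p => χ p.1 * s (m p))) p =
      χ p.1 * (deriv (deriv s) (m p) * ((-2 * (2 * R - 1)⁻¹) * p.2 j) ^ 2
        + deriv s (m p) * (-2 * (2 * R - 1)⁻¹)) := by
    intro j p
    have dco := (contDiff_coord (n := n) j).differentiable_of_smooth
    have h1 : Differentiable ℝ (fun p : ℝ × EuclideanSpace ℝ (Fin n) => χ p.1 * deriv s (m p)) :=
      df.mul ddsm
    have h2 : Differentiable ℝ (fun p : ℝ × EuclideanSpace ℝ (Fin n) =>
        (-2 * (2 * R - 1)⁻¹) * p.2 j) := dco.const_mul _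
    have h3 : Differentiable ℝ (fun _ : ℝ × EuclideanSpace ℝ (Fin n) => -2 * (2 * R - 1)⁻¹) :=
      differentiable_const _
    rw [dηj, dirDeriv_mul h1 h2, dirDeriv_mul df ddsm, dfv, dirDeriv_comp dds' dm, dmj,
      dirDeriv_mul h3 dco, dirDeriv_const, dirDeriv_coord]
    simp [spaceDir]
    ring
  have hinv : (2 * R - 1)⁻¹ ≤ 1 := inv_le_one_of_one_le₀ (by linarith)
  have hinvR : (2 * R - 1)⁻¹ * R ≤ 1 := by
    rw [inv_mul_le_iff₀ hc]; linarith
  have hinv0 : 0 < (2 * R - 1)⁻¹ := inv_pos.2 hc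
  have bcoord : ∀ (p : ℝ × EuclideanSpace ℝ (Fin n)) (j : Fin n), ‖p.2‖ < R →
      |(-2 * (2 * R - 1)⁻¹) * p.2 j| ≤ 2 := by
    intro p j hp
    have h1 : |p.2 j| ≤ R := (PiLp.norm_apply_le p.2 j).trans hp.le
    rw [abs_mul, abs_mul, abs_of_pos hinv0]
    norm_num
    have := mul_le_mul_of_nonneg_left h1 hinv0.le
    linarith
  have bj : ∀ (p : ℝ × EuclideanSpace ℝ (Fin n)) (j : Fin n),
      dirDeriv (spaceDir j) (fun p => χ p.1 * s (m p)) p ^ 2 ≤ (2 * K) ^ 2 := by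
    intro p j
    rw [dηj]
    by_cases h : deriv s (m p) = 0
    · simp only [h]; simp; positivity
    · refine sq_le_sq.2 ?_
      rw [abs_mul, abs_mul, abs_of_nonneg (by positivity : 0 ≤ 2 * K)]
      calc _ ≤ 1 * K * 2 := by
            gcongr
            · exact (hK' _).1
            · exact (hK _).2.1
            · exact bcoord p j (m0 p (ds _ h).1)
        _ = _ := by ring
  have bjj : ∀ (p : ℝ × EuclideanSpace ℝ (Fin n)) (j : Fin n),
      |dirDeriv (spaceDir j) (dirDeriv (spaceDir j) (fun p => χ p.1 * s (m p))) p| ≤ 6 * K := by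
    intro p j
    rw [dηjj, abs_mul]
    have h1 : |deriv (deriv s) (m p) * ((-2 * (2 * R - 1)⁻¹) * p.2 j) ^ 2| ≤ K * 2 ^ 2 := by
      by_cases h : deriv (deriv s) (m p) = 0
      · simp only [h]; simp; positivity
      · rw [abs_mul, abs_pow]
        gcongr
        · exact (hK _).2.2
        · exact bcoord p j (m0 p (dds _ h).1)
    have h2 : |deriv s (m p) * (-2 * (2 * R - 1)⁻¹)| ≤ K * 2 := by
      rw [abs_mul]
      gcongr
      · exact (hK _).2.1
      · rw [abs_mul, abs_of_pos hinv0]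
        norm_num
        linarith
    calc _ ≤ 1 * (K * 2 ^ 2 + K * 2) := by
          gcongr
          · exact (hK' _).1
          · exact (abs_add_le _ _).trans (add_le_add h1 h2)
      _ = _ := by ring
  refine ⟨fun p => χ p.1 * s (m p), ⟨hf.mul hsm, ?_⟩, ?_, ?_, ?_, ?_, ?_, ?_, ?_⟩
  · refine HasCompactSupport.of_support_subset_isCompact
      ((isCompact_closedBall (1 / 2 : ℝ) (7 / 16)).prod
        (isCompact_closedBall (0 : EuclideanSpace ℝ (Fin n)) R)) fun p hp => ?_
    have h1 := χ0 _ (left_ne_zero_of_mul hp)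
    have h2 : 0 < m p := by
      by_contra h
      exact right_ne_zero_of_mul hp (s0 _ (not_lt.1 h))
    refine ⟨?_, ?_⟩
    · simpa [Real.dist_eq] using h1.le
    · simpa using (m0 p h2).le
  · intro p hp
    refine ⟨χ0 _ (left_ne_zero_of_mul hp), m0 p ?_⟩
    by_contra h
    exact right_ne_zero_of_mul hp (s0 _ (not_lt.1 h))
  · intro p h1 h2
    simp [χ1 _ h1, s1 _ (m1' p h2)]
  · intro p
    rw [dητ]
    have : (deriv χ p.1 * s (m p)) ^ 2 ≤ (K' * K) ^ 2 := by
      refine sq_le_sq.2 ?_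
      rw [abs_mul, abs_of_nonneg (by positivity : 0 ≤ K' * K)]
      exact mul_le_mul (hK' _).2 (hK _).1 (abs_nonneg _) hK'0
    have : 0 ≤ (n * (6 * K)) ^ 2 := by positivity
    have : 0 ≤ n * (2 * K) ^ 2 := by positivity
    linarith
  · intro p hp
    rw [dητ] at hp
    refine ⟨dχ _ (left_ne_zero_of_mul hp), m0 p ?_⟩
    by_contra h
    exact right_ne_zero_of_mul hp (s0 _ (not_lt.1 h))
  · intro p
    have : (∑ j, dirDeriv (spaceDir j) (dirDeriv (spaceDir j) (fun p => χ p.1 * s (m p))) p) ^ 2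
        ≤ (n * (6 * K)) ^ 2 := by
      refine sq_le_sq.2 ?_
      rw [abs_of_nonneg (by positivity : 0 ≤ n * (6 * K))]
      refine (Finset.abs_sum_le_sum_abs _ _).trans ((Finset.sum_le_sum fun j _ => bjj p j).trans ?_)
      simp
    have : 0 ≤ n * (2 * K) ^ 2 := by positivity
    have : 0 ≤ (K' * K) ^ 2 := by positivity
    linarith
  · intro p
    have : ∑ j, dirDeriv (spaceDir j) (fun p => χ p.1 * s (m p)) p ^ 2 ≤ n * (2 * K) ^ 2 :=
      (Finset.sum_le_sum fun j _ => bj p j).trans (by simp)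
    have : 0 ≤ (n * (6 * K)) ^ 2 := by positivity
    have : 0 ≤ (K' * K) ^ 2 := by positivity
    linarith
  · intro p hp
    have h1 : deriv s (m p) = 0 := by
      by_contra h
      exact hp ⟨m1 p (ds _ h).2, m0 p (ds _ h).1⟩
    have h2 : deriv (deriv s) (m p) = 0 := by
      by_contra h
      exact hp ⟨m1 p (dds _ h).2, m0 p (dds _ h).1⟩
    exact ⟨Finset.sum_eq_zero fun j _ => by rw [dηjj, h1, h2]; ring,
      Finset.sum_eq_zero fun j _ => by rw [dηj]; simp only [h1]; ring⟩

end Cutoff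

/-! ### Reflections and space-time slices of test functions. -/

section Derivatives

variable {G : Type*} [NormedAddCommGroup G] [NormedSpace ℝ G]
  {F : Type*} [NormedAddCommGroup F] [NormedSpace ℝ F]

theorem dirDeriv_reflect {f : G → F} (hf : Differentiable ℝ f) (q v : G) :
    dirDeriv v (fun p => f (q - p)) = fun p => - dirDeriv v f (q - p) := by
  ext p
  have h := ((hf (q - p)).hasFDerivAt.comp p ((hasFDerivAt_id p).const_sub q)).fderiv
  change fderiv ℝ (f ∘ fun p => q - p) p v = _
  rw [h]
  simp [dirDeriv]

theorem dirDeriv_ofReal {f : G → ℝ} (hf : Differentiable ℝ f) (v : G) :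
    dirDeriv v (fun p => (f p : ℂ)) = fun p => ((dirDeriv v f p : ℝ) : ℂ) := by
  ext p
  have h := (Complex.ofRealCLM.hasFDerivAt.comp p (hf p).hasFDerivAt).fderiv
  change fderiv ℝ (fun p => (f p : ℂ)) p = _ at h
  simp [dirDeriv, h]

theorem IsTest.ofReal {f : G → ℝ} (hf : IsTest f) : IsTest (fun p => (f p : ℂ)) :=
  ⟨Complex.ofRealCLM.contDiff.comp hf.smooth, hf.supp.comp_left (g := Complex.ofReal) rfl⟩

theorem IsTest.reflect {f : G → F} (hf : IsTest f) (q : G) : IsTest (fun p => f (q - p)) :=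
  ⟨hf.smooth.comp (contDiff_const.sub contDiff_id),
    hf.supp.comp_homeomorph (Homeomorph.subLeft q)⟩

variable {n : ℕ}

theorem deriv_slice {f : ℝ × EuclideanSpace ℝ (Fin n) → F} (hf : Differentiable ℝ f)
    (p : ℝ × EuclideanSpace ℝ (Fin n)) :
    deriv (fun s => f (s, p.2)) p.1 = dirDeriv (timeDir n) f p := by
  have h := (hf (p.1, p.2)).hasFDerivAt.comp_hasDerivAt p.1
    ((hasDerivAt_id p.1).prodMk (hasDerivAt_const p.1 p.2))
  exact h.deriv

theorem fderiv_slice {f : ℝ × EuclideanSpace ℝ (Fin n) → F} (hf : Differentiable ℝ f)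
    (t : ℝ) (x v : EuclideanSpace ℝ (Fin n)) :
    fderiv ℝ (fun y => f (t, y)) x v = fderiv ℝ f (t, x) (0, v) := by
  have h := ((hf (t, x)).hasFDerivAt.comp x (hasFDerivAt_prodMk_right t x)).fderiv
  change fderiv ℝ (fun y => f (t, y)) x = _ at h
  rw [h]
  simp

theorem laplacian_slice {f : ℝ × EuclideanSpace ℝ (Fin n) → F} (hf : ContDiff ℝ ∞ f)
    (p : ℝ × EuclideanSpace ℝ (Fin n)) :
    Laplacian.laplacian (fun y => f (p.1, y)) p.2 =
      ∑ j, dirDeriv (spaceDir j) (dirDeriv (spaceDir j) f) p := by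
  have hs : ContDiff ℝ ∞ (fun y : EuclideanSpace ℝ (Fin n) => f (p.1, y)) :=
    hf.comp (contDiff_prodMk_right p.1)
  rw [InnerProductSpace.laplacian_eq_iteratedFDeriv_orthonormalBasis _
    (EuclideanSpace.basisFun (Fin n) ℝ)]
  refine Finset.sum_congr rfl fun j _ => ?_
  rw [iteratedFDeriv_two_apply]
  simp only [Matrix.cons_val_zero, Matrix.cons_val_one, EuclideanSpace.basisFun_apply]
  rw [← dirDeriv_dirDeriv hs]
  have h1 : dirDeriv (EuclideanSpace.single j (1 : ℝ)) (fun y => f (p.1, y)) =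
      fun y => dirDeriv (spaceDir j) f (p.1, y) := by
    ext y
    exact fderiv_slice hf.differentiable_of_smooth _ _ _
  rw [h1]
  exact fderiv_slice (contDiff_dirDeriv hf _).differentiable_of_smooth _ _ _

end Derivatives

/-! ### Square integrability on the strip and extension by zero. -/

section Strip

variable {n : ℕ}

/-- The closed space-time strip. -/
def strip (n : ℕ) : Set (ℝ × EuclideanSpace ℝ (Fin n)) := Set.Icc (0 : ℝ) 1 ×ˢ Set.univ

theorem measurableSet_strip : MeasurableSet (strip n) := measurableSet_Icc.prod MeasurableSet.univ

theorem stripMeasure_eq_restrict : stripMeasure n = volume.restrict (strip n) := by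
  rw [stripMeasure, strip, Measure.volume_eq_prod, ← Measure.prod_restrict, Measure.restrict_univ]

/-- A bounded curve in `L²` is square integrable on the strip. -/
theorem memLp_strip {F : Type*} [NormedAddCommGroup F] {f : ℝ → EuclideanSpace ℝ (Fin n) → F}
    (hm : AEStronglyMeasurable (fun p : ℝ × EuclideanSpace ℝ (Fin n) => f p.1 p.2) (stripMeasure n))
    (hf : ∀ t ∈ Set.Icc (0 : ℝ) 1, MemLp (f t) 2 volume)
    (hc : ∀ t₀ ∈ Set.Icc (0 : ℝ) 1, Tendsto (fun t => eLpNorm (fun x => f t x - f t₀ x) 2 volume)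
      (𝓝[Set.Icc (0 : ℝ) 1] t₀) (𝓝 0)) :
    MemLp (fun p : ℝ × EuclideanSpace ℝ (Fin n) => f p.1 p.2) 2 (stripMeasure n) := by
  obtain ⟨C, hC, hbd⟩ : ∃ C : ENNReal, C ≠ ⊤ ∧
      ∀ t ∈ Set.Icc (0 : ℝ) 1, eLpNorm (f t) 2 volume ≤ C := by
    -- A local bound follows from continuity at `t₀`; compactness of `[0,1]` makes it global.
    refine (isCompact_Icc (a := (0 : ℝ)) (b := 1)).induction_on
      (p := fun s => ∃ C : ENNReal, C ≠ ⊤ ∧ ∀ t ∈ s, eLpNorm (f t) 2 volume ≤ C)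
      ⟨0, by simp, by simp⟩ ?_ ?_ ?_
    · rintro s t hst ⟨C, hC, h⟩
      exact ⟨C, hC, fun x hx => h x (hst hx)⟩
    · rintro s t ⟨C, hC, h⟩ ⟨C', hC', h'⟩
      refine ⟨max C C', by simp [hC, hC'], fun x hx => ?_⟩
      rcases hx with hx | hx
      · exact (h x hx).trans (le_max_left _ _)
      · exact (h' x hx).trans (le_max_right _ _)
    · intro t₀ ht₀
      refine ⟨{t | t ∈ Set.Icc (0 : ℝ) 1 ∧ eLpNorm (fun x => f t x - f t₀ x) 2 volume < 1},
        (eventually_mem_nhdsWithin.and ((hc t₀ ht₀).eventually (gt_mem_nhds zero_lt_one))),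
        1 + eLpNorm (f t₀) 2 volume, by simp [(hf t₀ ht₀).2.ne], fun t ht => ?_⟩
      have h1 := eLpNorm_add_le ((hf t ht.1).1.sub (hf t₀ ht₀).1) (hf t₀ ht₀).1 (p := 2)
        (by norm_num)
      rw [sub_add_cancel] at h1
      exact h1.trans (by gcongr; exact ht.2.le)
  refine ⟨hm, ?_⟩
  rw [eLpNorm_lt_top_iff_lintegral_rpow_enorm_lt_top (by simp) (by simp)]
  simp only [ENNReal.toReal_ofNat]
  have hm' : AEMeasurable (fun p : ℝ × EuclideanSpace ℝ (Fin n) => ‖f p.1 p.2‖ₑ ^ (2 : ℝ))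
      ((volume.restrict (Set.Icc (0 : ℝ) 1)).prod volume) := hm.enorm.pow_const _
  rw [stripMeasure, lintegral_prod _ hm']
  calc _ ≤ ∫⁻ _ in Set.Icc (0 : ℝ) 1, C ^ (2 : ℝ) := by
        refine setLIntegral_mono measurable_const fun t ht => ?_
        have := hbd t ht
        rw [eLpNorm_eq_lintegral_rpow_enorm_toReal (by simp) (by simp)] at this
        simp only [ENNReal.toReal_ofNat] at this
        rwa [one_div, ENNReal.rpow_inv_le_iff (by norm_num)] at this
    _ < ⊤ := by simp [hC.lt_top]

variable {f : ℝ × EuclideanSpace ℝ (Fin n) → ℂ}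

theorem memLp_indicator_strip (hf : MemLp f 2 (stripMeasure n)) :
    MemLp ((strip n).indicator f) 2 volume := by
  rwa [memLp_indicator_iff_restrict measurableSet_strip, ← stripMeasure_eq_restrict]

theorem integrable_strip_smul (hf : MemLp f 2 (stripMeasure n))
    {ρ : ℝ × EuclideanSpace ℝ (Fin n) → ℝ} (hρ : IsTest ρ) (q : ℝ × EuclideanSpace ℝ (Fin n)) :
    Integrable (fun p => ρ (q - p) • f p) (stripMeasure n) := by
  have h := (hρ.reflect q)
  rw [stripMeasure_eq_restrict, ← IntegrableOn,
    ← integrable_indicator_iff measurableSet_strip]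
  have := ((memLp_indicator_strip hf).locallyIntegrable
    (by norm_num)).integrable_smul_left_of_hasCompactSupport h.smooth.continuous h.supp
  refine this.congr (Eventually.of_forall fun p => ?_)
  by_cases hp : p ∈ strip n <;> simp [hp]

theorem mollify_indicator_strip (ρ : ℝ × EuclideanSpace ℝ (Fin n) → ℝ)
    (q : ℝ × EuclideanSpace ℝ (Fin n)) :
    mollify volume ρ ((strip n).indicator f) q = ∫ p, ρ (q - p) • f p ∂(stripMeasure n) := by
  rw [mollify, stripMeasure_eq_restrict, ← integral_indicator measurableSet_strip]
  congr 1
  ext p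
  by_cases hp : p ∈ strip n <;> simp [hp]

end Strip

/-! ### Mollified form of the weak gradient and of the equation. -/

section Solutions

variable {n : ℕ} {V u : ℝ → EuclideanSpace ℝ (Fin n) → ℂ}
  {Du : ℝ → EuclideanSpace ℝ (Fin n) → EuclideanSpace ℂ (Fin n)}

theorem IsContinuousH1Curve.memLp_strip_fun (h : IsContinuousH1Curve u Du) :
    MemLp (fun p : ℝ × EuclideanSpace ℝ (Fin n) => u p.1 p.2) 2 (stripMeasure n) :=
  memLp_strip h.aestronglyMeasurable_fun h.memLp_fun h.tendsto_fun

theorem IsContinuousH1Curve.memLp_strip_grad (h : IsContinuousH1Curve u Du) :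
    MemLp (fun p : ℝ × EuclideanSpace ℝ (Fin n) => Du p.1 p.2) 2 (stripMeasure n) :=
  memLp_strip h.aestronglyMeasurable_grad h.memLp_grad h.tendsto_grad

theorem IsContinuousH1Curve.memLp_strip_grad_apply (h : IsContinuousH1Curve u Du) (l : Fin n) :
    MemLp (fun p : ℝ × EuclideanSpace ℝ (Fin n) => Du p.1 p.2 l) 2 (stripMeasure n) :=
  h.memLp_strip_grad.of_le
    ((EuclideanSpace.proj (𝕜 := ℂ) l).continuous.comp_aestronglyMeasurable
      h.aestronglyMeasurable_grad)
    (Eventually.of_forall fun p => PiLp.norm_apply_le (Du p.1 p.2) l)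

/-- The weak gradient is tested on each time slice with `x ↦ ρ (q - (t, x))`. No time derivative
occurs, so the jump of the zero extension at `t = 0, 1` does no harm and `q` is arbitrary. -/
theorem IsContinuousH1Curve.mollify_grad (h : IsContinuousH1Curve u Du)
    {ρ : ℝ × EuclideanSpace ℝ (Fin n) → ℝ} (hρ : IsTest ρ) (l : Fin n)
    (q : ℝ × EuclideanSpace ℝ (Fin n)) :
    mollify volume (dirDeriv (spaceDir l) ρ) ((strip n).indicator fun p => u p.1 p.2) q =
      mollify volume ρ ((strip n).indicator fun p => Du p.1 p.2 l) q := by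
  rw [mollify_indicator_strip, mollify_indicator_strip]
  have i1 := integrable_strip_smul h.memLp_strip_fun (hρ.deriv (spaceDir l)) q
  have i2 := integrable_strip_smul (h.memLp_strip_grad_apply l) hρ q
  rw [stripMeasure] at i1 i2 ⊢
  rw [integral_prod _ i1, integral_prod _ i2]
  refine setIntegral_congr_fun measurableSet_Icc fun t ht => ?_
  have hψ := (hρ.reflect q).ofReal
  have hs : ContDiff ℝ ∞ (fun x : EuclideanSpace ℝ (Fin n) => ((ρ (q - (t, x)) : ℝ) : ℂ)) :=
    hψ.smooth.comp (contDiff_prodMk_right t)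
  have hcs : HasCompactSupport
      (fun x : EuclideanSpace ℝ (Fin n) => ((ρ (q - (t, x)) : ℝ) : ℂ)) :=
    hψ.supp.comp_isClosedEmbedding
      (Topology.IsClosedEmbedding.of_continuous_injective_isClosedMap (by fun_prop)
        (Prod.mk_right_injective t) (isClosedMap_prodMk_left t))
  have key := h.hasWeakGradient t ht _ hs hcs l
  have hfd : ∀ x : EuclideanSpace ℝ (Fin n),
      fderiv ℝ (fun x : EuclideanSpace ℝ (Fin n) => ((ρ (q - (t, x)) : ℝ) : ℂ)) x
        (EuclideanSpace.single l 1) = -((dirDeriv (spaceDir l) ρ (q - (t, x)) : ℝ) : ℂ) := by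
    intro x
    rw [fderiv_slice (f := fun p => ((ρ (q - p) : ℝ) : ℂ)) hψ.smooth.differentiable_of_smooth]
    have h1 := congrFun (dirDeriv_ofReal (hρ.reflect q).smooth.differentiable_of_smooth
      (spaceDir l)) (t, x)
    rw [dirDeriv_reflect hρ.smooth.differentiable_of_smooth] at h1
    simpa [dirDeriv, spaceDir] using h1
  simp only [hfd, mul_neg, integral_neg, neg_inj] at key
  simp only [Complex.real_smul]
  simpa only [mul_comm] using key

theorem ae_norm_potential_mul_le {L : ℝ}
    (hV : eLpNorm (fun p : ℝ × EuclideanSpace ℝ (Fin n) => V p.1 p.2) ⊤ (stripMeasure n)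
      ≤ ENNReal.ofReal L) :
    ∀ᵐ p ∂(stripMeasure n), ‖-(V p.1 p.2 * u p.1 p.2)‖ ≤ max L 0 * ‖u p.1 p.2‖ := by
  rw [eLpNorm_exponent_top] at hV
  filter_upwards [ae_le_eLpNormEssSup (f := fun p : ℝ × EuclideanSpace ℝ (Fin n) => V p.1 p.2)
    (μ := stripMeasure n)] with p hp
  rw [norm_neg, norm_mul]
  gcongr
  have h1 := hp.trans hV
  rw [← ofReal_norm] at h1
  exact (ENNReal.ofReal_le_ofReal_iff (le_max_right _ _)).1
    (h1.trans (ENNReal.ofReal_le_ofReal (le_max_left _ _)))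

theorem IsStrongSolution.memLp_strip_potential (h : IsStrongSolution V u Du) {L : ℝ}
    (hVm : MemLp (fun p : ℝ × EuclideanSpace ℝ (Fin n) => V p.1 p.2) ⊤ (stripMeasure n))
    (hV : eLpNorm (fun p : ℝ × EuclideanSpace ℝ (Fin n) => V p.1 p.2) ⊤ (stripMeasure n)
      ≤ ENNReal.ofReal L) :
    MemLp (fun p : ℝ × EuclideanSpace ℝ (Fin n) => -(V p.1 p.2 * u p.1 p.2)) 2 (stripMeasure n) :=
  h.curve.memLp_strip_fun.of_le_mul (hVm.1.mul h.curve.aestronglyMeasurable_fun).neg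
    (ae_norm_potential_mul_le hV)

/-- The equation is tested with `p ↦ ρ (q - p)`. Reflection changes the sign of first derivatives,
matching the `-i∂_t` of the distributional form, and preserves second ones. -/
theorem IsStrongSolution.mollify_equation (h : IsStrongSolution V u Du)
    (hF : MemLp (fun p : ℝ × EuclideanSpace ℝ (Fin n) => -(V p.1 p.2 * u p.1 p.2)) 2
      (stripMeasure n))
    {ρ : ℝ × EuclideanSpace ℝ (Fin n) → ℝ} (hρ : IsTest ρ)
    (hsupp : Function.support ρ ⊆ Metric.ball 0 (1 / 32)) {q : ℝ × EuclideanSpace ℝ (Fin n)}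
    (hq : |q.1 - 1 / 2| < 7 / 16) :
    Complex.I * mollify volume (dirDeriv (timeDir n) ρ)
        ((strip n).indicator fun p => u p.1 p.2) q
      + ∑ j, mollify volume (dirDeriv (spaceDir j) (dirDeriv (spaceDir j) ρ))
        ((strip n).indicator fun p => u p.1 p.2) q
      = mollify volume ρ ((strip n).indicator fun p => -(V p.1 p.2 * u p.1 p.2)) q := by
  have hψ := (hρ.reflect q).ofReal
  -- Here `7/16 + 1/32 < 1/2` keeps the support inside the open time interval.
  have hts : tsupport (fun p => ((ρ (q - p) : ℝ) : ℂ)) ⊆ Set.Ioo (0 : ℝ) 1 ×ˢ Set.univ := by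
    have h1 : tsupport (fun p => ((ρ (q - p) : ℝ) : ℂ)) ⊆ Metric.closedBall q (1 / 32) := by
      refine closure_minimal (fun p hp => ?_) Metric.isClosed_closedBall
      have h2 : q - p ∈ Function.support ρ := fun h0 => hp (by simp [h0])
      have h3 := hsupp h2
      rw [mem_ball_zero_iff] at h3
      rw [mem_closedBall_iff_norm']
      exact h3.le
    intro p hp
    have h4 := h1 hp
    rw [mem_closedBall_iff_norm'] at h4
    have h5 := (norm_fst_le (q - p)).trans h4
    rw [Real.norm_eq_abs, Prod.fst_sub, abs_le] at h5
    rw [abs_lt] at hq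
    exact ⟨⟨by linarith [h5.2, hq.1], by linarith [h5.1, hq.2]⟩, trivial⟩
  have key := h.equation _ hψ.smooth hψ.supp hts
  have d0 := hρ.smooth.differentiable_of_smooth
  have dv : ∀ v, dirDeriv v (fun p => ((ρ (q - p) : ℝ) : ℂ)) =
      fun p => ((-dirDeriv v ρ (q - p) : ℝ) : ℂ) := fun v => by
    rw [dirDeriv_ofReal (hρ.reflect q).smooth.differentiable_of_smooth, dirDeriv_reflect d0]
  have dvv : ∀ v, dirDeriv v (dirDeriv v (fun p => ((ρ (q - p) : ℝ) : ℂ))) =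
      fun p => ((dirDeriv v (dirDeriv v ρ) (q - p) : ℝ) : ℂ) := fun v => by
    have hv := hρ.deriv v
    rw [dv, dirDeriv_ofReal (hv.neg.reflect q).smooth.differentiable_of_smooth,
      dirDeriv_reflect hv.neg.smooth.differentiable_of_smooth]
    ext p
    have : dirDeriv v (fun p => -dirDeriv v ρ p) (q - p) = -dirDeriv v (dirDeriv v ρ) (q - p) := by
      simp only [dirDeriv]
      rw [fderiv_fun_neg]
      rfl
    beta_reduce
    rw [this, neg_neg]
  have hu := h.curve.memLp_strip_fun
  have i1 := (integrable_strip_smul hu (hρ.deriv (timeDir n)) q).const_mul Complex.I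
  have i2 := fun j : Fin n =>
    integrable_strip_smul hu ((hρ.deriv (spaceDir j)).deriv (spaceDir j)) q
  have i3 := integrable_strip_smul hF hρ q
  simp only [mollify_indicator_strip]
  rw [← sub_eq_zero, ← integral_const_mul, ← integral_finsetSum _ fun j _ => i2 j,
    ← integral_add i1 (integrable_finsetSum _ fun j _ => i2 j)]
  have i12 := i1.add (integrable_finsetSum Finset.univ fun j _ => i2 j)
  simp only [Pi.add_def] at i12
  rw [← integral_sub i12 i3, ← key]
  congr 1
  ext p
  rw [deriv_slice hψ.smooth.differentiable_of_smooth, laplacian_slice hψ.smooth, dv]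
  simp only [dvv, Complex.real_smul, ← Finset.sum_mul]
  push_cast
  ring

end Solutions

/-! ### The concrete weight and the mass inequality. -/

section LowerBound

variable {n : ℕ}

/-- The exponent of the Carleman weight: convex in one space variable, concave in time. -/
def carlemanWeight (i : Fin n) (R : ℝ) (p : ℝ × EuclideanSpace ℝ (Fin n)) : ℝ :=
  2 * ((p.2 i + 2 * R) ^ 2 - 48 * R ^ 2 * (p.1 - 1 / 2) ^ 2)

theorem contDiff_carlemanWeight (i : Fin n) (R : ℝ) : ContDiff ℝ ∞ (carlemanWeight i R) := by
  have := contDiff_coord (n := n) i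
  unfold carlemanWeight
  fun_prop

theorem dirDeriv_shifted_coord (i : Fin n) (R : ℝ) (v p : ℝ × EuclideanSpace ℝ (Fin n)) :
    dirDeriv v (fun q : ℝ × EuclideanSpace ℝ (Fin n) => q.2 i + 2 * R) p = v.2 i := by
  have := (contDiff_coord (n := n) i).differentiable_of_smooth
  rw [dirDeriv_add this (by fun_prop), dirDeriv_coord, dirDeriv_const, add_zero]

theorem dirDeriv_carlemanWeight (i : Fin n) (R : ℝ) (v : ℝ × EuclideanSpace ℝ (Fin n)) :
    dirDeriv v (carlemanWeight i R) =
      fun p => 4 * (p.2 i + 2 * R) * v.2 i - 192 * R ^ 2 * (p.1 - 1 / 2) * v.1 := by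
  ext p
  have := (contDiff_coord (n := n) i).differentiable_of_smooth
  unfold carlemanWeight
  simp (disch := fun_prop) only [dirDeriv_mul, dirDeriv_sub, dirDeriv_pow, dirDeriv_const,
    dirDeriv_shifted_coord, dirDeriv_fst]
  norm_num
  ring

theorem dirDeriv_dirDeriv_carlemanWeight (i : Fin n) (R : ℝ) (p : ℝ × EuclideanSpace ℝ (Fin n)) :
    dirDeriv (timeDir n) (dirDeriv (timeDir n) (carlemanWeight i R)) p = -192 * R ^ 2 := by
  rw [dirDeriv_carlemanWeight]
  have := (contDiff_coord (n := n) i).differentiable_of_smooth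
  simp (disch := fun_prop) only [dirDeriv_mul, dirDeriv_sub, dirDeriv_const,
    dirDeriv_shifted_coord, dirDeriv_fst]
  simp [timeDir]

/-- The worst case is `2((2R-1)² - (3/4)R²) = (13/2)R² - 8R + 2`; the condition `R ≥ 6` absorbs the
linear term. -/
theorem carlemanWeight_ge {i : Fin n} {R : ℝ} (hR : 6 ≤ R) {p : ℝ × EuclideanSpace ℝ (Fin n)}
    (ht : |p.1 - 1 / 2| ≤ 1 / 8) (hx : ‖p.2‖ < 1) : 5 * R ^ 2 ≤ carlemanWeight i R p := by
  have h1 : |p.2 i| ≤ 1 := (PiLp.norm_apply_le p.2 i).trans hx.le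
  have h2 : (p.1 - 1 / 2) ^ 2 ≤ (1 / 8) ^ 2 :=
    sq_le_sq.2 (by rwa [abs_of_pos (by norm_num : (0 : ℝ) < 1 / 8)])
  have h3 : (2 * R - 1) ^ 2 ≤ (p.2 i + 2 * R) ^ 2 := by
    have := (abs_le.1 h1).1
    gcongr
    · linarith
    · linarith
  have h4 := mul_le_mul_of_nonneg_left h2 (sq_nonneg R)
  unfold carlemanWeight
  nlinarith

theorem carlemanWeight_le {i : Fin n} {R : ℝ} {p : ℝ × EuclideanSpace ℝ (Fin n)}
    (hx : ‖p.2‖ < R) : carlemanWeight i R p ≤ 18 * R ^ 2 := by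
  have h1 : |p.2 i| ≤ R := (PiLp.norm_apply_le p.2 i).trans hx.le
  have h3 : (p.2 i + 2 * R) ^ 2 ≤ (3 * R) ^ 2 := by
    have := abs_le.1 h1
    gcongr
    · linarith
    · linarith
  have h4 := mul_nonneg (sq_nonneg R) (sq_nonneg (p.1 - 1 / 2))
  unfold carlemanWeight
  nlinarith

/-- At these times the concave part takes off `48 · 9/64 = 27/4` from the spatial maximum `9`, which
brings the weight below its value `5R²` near the origin. -/
theorem carlemanWeight_le_of_far {i : Fin n} {R : ℝ} {p : ℝ × EuclideanSpace ℝ (Fin n)}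
    (ht : 3 / 8 ≤ |p.1 - 1 / 2|) (hx : ‖p.2‖ < R) : carlemanWeight i R p ≤ 9 / 2 * R ^ 2 := by
  have h1 : |p.2 i| ≤ R := (PiLp.norm_apply_le p.2 i).trans hx.le
  have h2 : (3 / 8) ^ 2 ≤ (p.1 - 1 / 2) ^ 2 := by
    rw [← sq_abs (p.1 - 1 / 2)]; gcongr
  have h3 : (p.2 i + 2 * R) ^ 2 ≤ (3 * R) ^ 2 := by
    have := abs_le.1 h1
    gcongr
    · linarith
    · linarith
  have h4 := mul_le_mul_of_nonneg_left h2 (sq_nonneg R)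
  unfold carlemanWeight
  nlinarith

/-- The annulus `R - 1 < |x| < R`. -/
def annulus (n : ℕ) (R : ℝ) : Set (EuclideanSpace ℝ (Fin n)) := {x | R - 1 < ‖x‖ ∧ ‖x‖ < R}

theorem measurableSet_annulus (R : ℝ) : MeasurableSet (annulus n R) :=
  (measurableSet_lt measurable_const measurable_norm).inter
    (measurableSet_lt measurable_norm measurable_const)

theorem intervalIntegral_eq_setIntegral_prod {a b : ℝ} (hab : a ≤ b)
    {s : Set (EuclideanSpace ℝ (Fin n))} {f : ℝ × EuclideanSpace ℝ (Fin n) → ℝ}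
    (hf : IntegrableOn f (Set.Icc a b ×ˢ s) volume) :
    ∫ t in a..b, ∫ x in s, f (t, x) = ∫ p in Set.Icc a b ×ˢ s, f p := by
  rw [intervalIntegral.integral_of_le hab, ← integral_Icc_eq_integral_Ioc, Measure.volume_eq_prod,
    setIntegral_prod _ (by rwa [← Measure.volume_eq_prod])]

variable {V u : ℝ → EuclideanSpace ℝ (Fin n) → ℂ}
  {Du : ℝ → EuclideanSpace ℝ (Fin n) → EuclideanSpace ℂ (Fin n)}

theorem IsContinuousH1Curve.integrableOn_energy (h : IsContinuousH1Curve u Du) :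
    IntegrableOn (fun p : ℝ × EuclideanSpace ℝ (Fin n) => ‖u p.1 p.2‖ ^ 2 + ‖Du p.1 p.2‖ ^ 2)
      (strip n) volume := by
  rw [IntegrableOn, ← stripMeasure_eq_restrict]
  exact (h.memLp_strip_fun.integrable_norm_pow (by norm_num)).add
    (h.memLp_strip_grad.integrable_norm_pow (by norm_num))

theorem IsContinuousH1Curve.integral_energy_eq (h : IsContinuousH1Curve u Du) :
    ∫ t in (0 : ℝ)..1, ∫ x, (‖u t x‖ ^ 2 + ‖Du t x‖ ^ 2) =
      ∫ p in strip n, (‖u p.1 p.2‖ ^ 2 + ‖Du p.1 p.2‖ ^ 2) := by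
  have := intervalIntegral_eq_setIntegral_prod zero_le_one h.integrableOn_energy
  simp only [Measure.restrict_univ] at this
  exact this

theorem IsContinuousH1Curve.annulusNorm_sq (h : IsContinuousH1Curve u Du) (R : ℝ) :
    annulusNorm u Du R ^ 2 =
      ∫ p in Set.Icc (0 : ℝ) 1 ×ˢ annulus n R, (‖u p.1 p.2‖ ^ 2 + ‖Du p.1 p.2‖ ^ 2) := by
  have h1 := intervalIntegral_eq_setIntegral_prod zero_le_one
    (h.integrableOn_energy.mono_set (Set.prod_mono_right (Set.subset_univ (annulus n R))))
  rw [← h1, annulusNorm]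
  refine Real.sq_sqrt (intervalIntegral.integral_nonneg zero_le_one fun t _ => ?_)
  exact integral_nonneg fun x => by positivity

/-- The weighted inequality that relates the mass of a solution near the origin to its energy and
to its norm on an annulus. -/
theorem IsStrongSolution.mass_le (hn : 1 ≤ n) : ∃ K : ℝ, 0 < K ∧ ∀ L R : ℝ, 6 ≤ R →
    3 * L ^ 2 ≤ 127 * R ^ 2 → 0 ≤ L →
    ∀ (V u : ℝ → EuclideanSpace ℝ (Fin n) → ℂ)
      (Du : ℝ → EuclideanSpace ℝ (Fin n) → EuclideanSpace ℂ (Fin n)),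
    MemLp (fun p : ℝ × EuclideanSpace ℝ (Fin n) => V p.1 p.2) ⊤ (stripMeasure n) →
    eLpNorm (fun p : ℝ × EuclideanSpace ℝ (Fin n) => V p.1 p.2) ⊤ (stripMeasure n)
      ≤ ENNReal.ofReal L →
    IsStrongSolution V u Du →
    R ^ 2 * Real.exp (10 * R ^ 2) *
      ∫ p in Set.Icc (1 / 2 - 1 / 8 : ℝ) (1 / 2 + 1 / 8) ×ˢ
        {x : EuclideanSpace ℝ (Fin n) | ‖x‖ < 1}, ‖u p.1 p.2‖ ^ 2 ≤
      K * Real.exp (9 * R ^ 2) * (∫ p in strip n, (‖u p.1 p.2‖ ^ 2 + ‖Du p.1 p.2‖ ^ 2))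
      + K * Real.exp (36 * R ^ 2) * ∫ p in Set.Icc (0 : ℝ) 1 ×ˢ annulus n R,
        (‖u p.1 p.2‖ ^ 2 + ‖Du p.1 p.2‖ ^ 2) := by
  obtain ⟨K, hK, hcut⟩ := exists_spacetime_cutoff n
  refine ⟨30 * K, by positivity, fun L R hR hLR hL V u Du hVm hV hsol => ?_⟩
  obtain ⟨η, hη, η0, η1, bτ, ητ, bL, bG, hann⟩ := hcut R (by linarith)
  let i : Fin n := ⟨0, hn⟩
  let S := strip n
  have hSm : MeasurableSet S := measurableSet_strip
  let U := S.indicator fun p => u p.1 p.2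
  let F := S.indicator fun p => -(V p.1 p.2 * u p.1 p.2)
  let D := fun l : Fin n => S.indicator fun p => Du p.1 p.2 l
  let w := carlemanWeight i R
  have hFm := hsol.memLp_strip_potential hVm hV
  have hU2 : MemLp U 2 volume := memLp_indicator_strip hsol.curve.memLp_strip_fun
  have hF2 : MemLp F 2 volume := memLp_indicator_strip hFm
  have hD2 : ∀ l, MemLp (D l) 2 volume := fun l =>
    memLp_indicator_strip (hsol.curve.memLp_strip_grad_apply l)
  have hvol : (volume : Measure (ℝ × EuclideanSpace ℝ (Fin n))).IsAddHaarMeasure := by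
    rw [Measure.volume_eq_prod]; infer_instance
  -- With `α = 2` and `κ = -192R²` the coefficient is `512X² - 384R²`, and `X ≥ R` on the support of
  -- `η` gives `M = 128R²`.
  have main := carleman_weak (μ := (volume : Measure (ℝ × EuclideanSpace ℝ (Fin n)))) hη hU2 hF2 hD2
    (X := fun q => q.2 i + 2 * R) ((contDiff_coord i).add contDiff_const)
    (contDiff_carlemanWeight i R) (τ := timeDir n) (e := spaceDir) (i := i) (κ := -192 * R ^ 2)
    (α := 2) (M := 128 * R ^ 2) (by norm_num)
    (fun j p => by
      rw [dirDeriv_shifted_coord]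
      simp [spaceDir, eq_comm])
    (fun p => by
      rw [dirDeriv_shifted_coord]
      simp [timeDir])
    (fun j p => by
      rw [dirDeriv_carlemanWeight]
      by_cases hj : j = i
      · simp [spaceDir, hj]; left; ring
      · simp [spaceDir, hj, Ne.symm hj])
    (dirDeriv_dirDeriv_carlemanWeight i R)
    (fun p hp => by
      have h1 : |p.2 i| ≤ R := (PiLp.norm_apply_le p.2 i).trans (η0 p hp).2.le
      have h2 := (abs_le.1 h1).1
      have h3 : R ^ 2 ≤ (p.2 i + 2 * R) ^ 2 := by
        gcongr
        linarith
      linarith)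
    (fun ρ hρ l q => hsol.curve.mollify_grad hρ l q)
    (r := 1 / 32) (by norm_num)
    (fun ρ hρ hs q hq => hsol.mollify_equation hFm hρ hs (η0 q hq).1)
  have hE : ∀ (p : ℝ × EuclideanSpace ℝ (Fin n)) (a : ℝ), w p ≤ a →
      Real.exp (w p) ^ 2 ≤ Real.exp (2 * a) := by
    intro p a h
    rw [← Real.exp_nat_mul]
    exact Real.exp_le_exp.2 (by push_cast; linarith)
  have cw : Continuous w := (contDiff_carlemanWeight i R).continuous
  have cη := hη.smooth.continuous
  have hwt : ∀ {m : ℝ × EuclideanSpace ℝ (Fin n) → ℝ}, Continuous m → HasCompactSupport m →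
      ∀ {f : ℝ × EuclideanSpace ℝ (Fin n) → ℂ}, MemLp f 2 volume →
      Integrable (fun p => m p * ‖f p‖ ^ 2) volume := by
    intro m hm hmc f hf
    obtain ⟨C, hC⟩ := hm.bounded_above_of_compact_support hmc
    exact (hf.integrable_norm_pow (by norm_num)).bdd_mul hm.aestronglyMeasurable
      (Eventually.of_forall hC)
  have cη2 : HasCompactSupport fun p => η p ^ 2 :=
    hη.supp.comp_left (g := fun y : ℝ => y ^ 2) (by norm_num)
  have iU : Integrable (fun p => (Real.exp (w p) ^ 2 * η p ^ 2) * ‖U p‖ ^ 2) volume :=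
    hwt (by fun_prop) cη2.mul_left hU2
  -- the potential term
  have hFU : ∀ᵐ p, ‖F p‖ ^ 2 ≤ L ^ 2 * ‖U p‖ ^ 2 := by
    have h1 := ae_norm_potential_mul_le (u := u) hV
    rw [stripMeasure_eq_restrict, ae_restrict_iff' measurableSet_strip, max_eq_left hL] at h1
    filter_upwards [h1] with p hp
    by_cases hpS : p ∈ S
    · simp only [F, U, Set.indicator_of_mem hpS]
      rw [← mul_pow]
      exact pow_le_pow_left₀ (norm_nonneg _) (hp hpS) 2
    · simp [F, U, Set.indicator_of_notMem hpS]
  have tF : ∫ p, (3 * Real.exp (w p) ^ 2 * η p ^ 2) * ‖F p‖ ^ 2 ≤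
      3 * L ^ 2 * ∫ p, (Real.exp (w p) ^ 2 * η p ^ 2) * ‖U p‖ ^ 2 := by
    rw [← integral_const_mul]
    refine integral_mono_of_nonneg (Eventually.of_forall fun p => by positivity)
      (iU.const_mul _) ?_
    filter_upwards [hFU] with p hp
    calc _ ≤ (3 * Real.exp (w p) ^ 2 * η p ^ 2) * (L ^ 2 * ‖U p‖ ^ 2) := by gcongr
      _ = _ := by ring
  -- the main term
  let Q := Set.Icc (1 / 2 - 1 / 8 : ℝ) (1 / 2 + 1 / 8) ×ˢ
    {x : EuclideanSpace ℝ (Fin n) | ‖x‖ < 1}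
  have hQm : MeasurableSet Q :=
    measurableSet_Icc.prod (measurableSet_lt measurable_norm measurable_const)
  have hQS : ∀ p ∈ Q, p ∈ S := fun p hp =>
    ⟨⟨by linarith [hp.1.1], by linarith [hp.1.2]⟩, trivial⟩
  have tU : Real.exp (10 * R ^ 2) * ∫ p in Q, ‖u p.1 p.2‖ ^ 2 ≤
      ∫ p, (Real.exp (w p) ^ 2 * η p ^ 2) * ‖U p‖ ^ 2 := by
    rw [← integral_const_mul]
    calc ∫ p in Q, Real.exp (10 * R ^ 2) * ‖u p.1 p.2‖ ^ 2
        ≤ ∫ p in Q, (Real.exp (w p) ^ 2 * η p ^ 2) * ‖U p‖ ^ 2 := by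
          refine integral_mono_of_nonneg (Eventually.of_forall fun p => by positivity)
            iU.integrableOn ((ae_restrict_iff' hQm).2 (Eventually.of_forall fun p hp => ?_))
          have ht : |p.1 - 1 / 2| ≤ 1 / 8 :=
            abs_le.2 ⟨by linarith [hp.1.1], by linarith [hp.1.2]⟩
          have hx : ‖p.2‖ < 1 := hp.2
          have h1 : η p = 1 := η1 p (ht.trans (by norm_num)) (by linarith)
          have h2 : U p = u p.1 p.2 := Set.indicator_of_mem (hQS p hp) _
          simp only [h1, h2, one_pow, mul_one]
          gcongr
          rw [← Real.exp_nat_mul]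
          have := carlemanWeight_ge (i := i) hR ht hx
          exact Real.exp_le_exp.2 (by push_cast; linarith)
      _ ≤ _ := setIntegral_le_integral iU (Eventually.of_forall fun p => by positivity)
  -- the error terms
  let S' := Set.Icc (0 : ℝ) 1 ×ˢ annulus n R
  have hS'm : MeasurableSet S' := measurableSet_Icc.prod (measurableSet_annulus R)
  have hS'S : S' ⊆ S := Set.prod_mono_right (Set.subset_univ _)
  have henS : IntegrableOn _ S volume := hsol.curve.integrableOn_energy
  have henS' := henS.mono_set hS'S
  have hL' : IsTest (fun p => ∑ j, dirDeriv (spaceDir j) (dirDeriv (spaceDir j) η) p) :=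
    IsTest.sum _ fun j => (hη.deriv _).deriv _
  have cτ := (hη.deriv (timeDir n)).smooth.continuous
  have cL := hL'.smooth.continuous
  have h2 : ∀ {f : ℝ × EuclideanSpace ℝ (Fin n) → ℝ}, IsTest f → IsTest (fun p => f p ^ 2) :=
    fun hf => by simpa only [sq] using hf.mul_left hf.smooth
  have hG : IsTest (fun p => ∑ j, dirDeriv (spaceDir j) η p ^ 2) :=
    IsTest.sum _ fun j => h2 (hη.deriv _)
  have cG := hG.smooth.continuous
  have i2 : Integrable (fun p => (Real.exp (w p) ^ 2 * (3 * dirDeriv (timeDir n) η p ^ 2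
      + 6 * (∑ j, dirDeriv (spaceDir j) (dirDeriv (spaceDir j) η) p) ^ 2)) * ‖U p‖ ^ 2) volume :=
    hwt (by fun_prop)
      ((((h2 (hη.deriv (timeDir n))).mul_left (contDiff_const (c := 3))).add
        ((h2 hL').mul_left (contDiff_const (c := 6)))).supp.mul_left) hU2
  have i3 : ∀ l, Integrable (fun p => (24 * Real.exp (w p) ^ 2 *
      ∑ j, dirDeriv (spaceDir j) η p ^ 2) * ‖D l p‖ ^ 2) volume := fun l =>
    hwt (by fun_prop) hG.supp.mul_left (hD2 l)
  have tE : (∫ p, (Real.exp (w p) ^ 2 * (3 * dirDeriv (timeDir n) η p ^ 2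
          + 6 * (∑ j, dirDeriv (spaceDir j) (dirDeriv (spaceDir j) η) p) ^ 2)) * ‖U p‖ ^ 2)
      + ∑ l, ∫ p, (24 * Real.exp (w p) ^ 2 * ∑ j, dirDeriv (spaceDir j) η p ^ 2) * ‖D l p‖ ^ 2 ≤
      30 * K * Real.exp (9 * R ^ 2) * (∫ p in S, (‖u p.1 p.2‖ ^ 2 + ‖Du p.1 p.2‖ ^ 2))
      + 30 * K * Real.exp (36 * R ^ 2) * ∫ p in S', (‖u p.1 p.2‖ ^ 2 + ‖Du p.1 p.2‖ ^ 2) := by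
    rw [← integral_indicator hSm, ← integral_indicator hS'm,
      ← integral_const_mul, ← integral_const_mul, ← integral_finsetSum _ fun l _ => i3 l,
      ← integral_add i2 (integrable_finsetSum _ fun l _ => i3 l),
      ← integral_add ((henS.integrable_indicator hSm).const_mul _)
        ((henS'.integrable_indicator hS'm).const_mul _)]
    refine integral_mono_of_nonneg (Eventually.of_forall fun p => by positivity)
      (((henS.integrable_indicator hSm).const_mul _).add
        ((henS'.integrable_indicator hS'm).const_mul _)) (Eventually.of_forall fun p => ?_)
    beta_reduce
    rw [← Finset.mul_sum]
    by_cases hpS : p ∈ S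
    swap
    · have hpS' : p ∉ S' := fun h => hpS (hS'S h)
      simp [U, D, Set.indicator_of_notMem hpS, Set.indicator_of_notMem hpS']
    have hDu : ∑ l, ‖D l p‖ ^ 2 = ‖Du p.1 p.2‖ ^ 2 := by
      simp only [D, Set.indicator_of_mem hpS]
      rw [EuclideanSpace.norm_sq_eq]
    rw [hDu]
    simp only [U, Set.indicator_of_mem hpS]
    -- The time derivative of `η` lives at the far times only, where the weight is small even inside
    -- the ball.
    have hterm : Real.exp (w p) ^ 2 * dirDeriv (timeDir n) η p ^ 2 ≤ K * Real.exp (9 * R ^ 2) := by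
      by_cases h0 : dirDeriv (timeDir n) η p = 0
      · rw [h0]
        have : 0 ≤ K * Real.exp (9 * R ^ 2) := by positivity
        simpa using this
      · have h3 := hE p _ (carlemanWeight_le_of_far (i := i) (ητ p h0).1 (ητ p h0).2)
        calc _ ≤ Real.exp (2 * (9 / 2 * R ^ 2)) * K := by gcongr; exact bτ p
          _ = _ := by rw [mul_comm]; congr 2; ring
    have hu0 : 0 ≤ ‖u p.1 p.2‖ ^ 2 := by positivity
    have hD0 : 0 ≤ ‖Du p.1 p.2‖ ^ 2 := by positivity
    have hA := mul_le_mul_of_nonneg_right hterm hu0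
    have hB : 0 ≤ K * Real.exp (9 * R ^ 2) * ‖u p.1 p.2‖ ^ 2 := by positivity
    have hC : 0 ≤ K * Real.exp (9 * R ^ 2) * ‖Du p.1 p.2‖ ^ 2 := by positivity
    by_cases hpa : p.2 ∈ annulus n R
    · have hpS' : p ∈ S' := ⟨hpS.1, hpa⟩
      rw [Set.indicator_of_mem hpS']
      have h3 := hE p _ (carlemanWeight_le (i := i) hpa.2)
      rw [(by ring : 2 * (18 * R ^ 2) = 36 * R ^ 2)] at h3
      have h4 : Real.exp (w p) ^ 2 *
          (∑ j, dirDeriv (spaceDir j) (dirDeriv (spaceDir j) η) p) ^ 2 ≤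
          Real.exp (36 * R ^ 2) * K := by gcongr; exact bL p
      have h5 : Real.exp (w p) ^ 2 * ∑ j, dirDeriv (spaceDir j) η p ^ 2 ≤
          Real.exp (36 * R ^ 2) * K := by gcongr; exact bG p
      have h6 := mul_le_mul_of_nonneg_right h4 hu0
      have h7 := mul_le_mul_of_nonneg_right h5 hD0
      have h8 : 0 ≤ Real.exp (36 * R ^ 2) * K * ‖u p.1 p.2‖ ^ 2 := by positivity
      have h9 : 0 ≤ Real.exp (36 * R ^ 2) * K * ‖Du p.1 p.2‖ ^ 2 := by positivity
      linarith
    · have hpS' : p ∉ S' := fun h => hpa h.2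
      rw [Set.indicator_of_notMem hpS', (hann p hpa).1, (hann p hpa).2]
      linarith
  have hM0 : 0 ≤ ∫ p, (Real.exp (w p) ^ 2 * η p ^ 2) * ‖U p‖ ^ 2 :=
    integral_nonneg fun p => by positivity
  have f1 := mul_le_mul_of_nonneg_left tU (sq_nonneg R)
  -- The potential uses up `127R²` of the available `128R²`, leaving the factor `R²` of the
  -- conclusion.
  have f2 := mul_le_mul_of_nonneg_right hLR hM0
  simp only [show carlemanWeight i R = w from rfl] at main
  change R ^ 2 * Real.exp (10 * R ^ 2) * (∫ p in Q, ‖u p.1 p.2‖ ^ 2) ≤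
    30 * K * Real.exp (9 * R ^ 2) * (∫ p in S, (‖u p.1 p.2‖ ^ 2 + ‖Du p.1 p.2‖ ^ 2))
      + 30 * K * Real.exp (36 * R ^ 2) * ∫ p in S', (‖u p.1 p.2‖ ^ 2 + ‖Du p.1 p.2‖ ^ 2)
  rw [mul_assoc (R ^ 2)]
  linarith

end LowerBound

end

/-! ### Choice of constants and conclusion. -/

theorem theorem3p2 (n : ℕ) (hn : 1 ≤ n) :
    ∃ c : ℝ, 0 < c ∧ ∀ A L : ℝ, ∃ R₀ : ℝ, 0 < R₀ ∧
      ∀ (V u : ℝ → EuclideanSpace ℝ (Fin n) → ℂ)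
        (Du : ℝ → EuclideanSpace ℝ (Fin n) → EuclideanSpace ℂ (Fin n)),
        MemLp (fun p : ℝ × EuclideanSpace ℝ (Fin n) => V p.1 p.2) ⊤ (stripMeasure n) →
        eLpNorm (fun p : ℝ × EuclideanSpace ℝ (Fin n) => V p.1 p.2) ⊤ (stripMeasure n)
          ≤ ENNReal.ofReal L →
        IsStrongSolution V u Du →
        ∫ t in (0 : ℝ)..1, ∫ x, (‖u t x‖ ^ 2 + ‖Du t x‖ ^ 2) ≤ A ^ 2 →
        1 ≤ ∫ t in (1 / 2 - 1 / 8 : ℝ)..(1 / 2 + 1 / 8),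
          ∫ x in {x : EuclideanSpace ℝ (Fin n) | ‖x‖ < 1}, ‖u t x‖ ^ 2 →
        ∀ R : ℝ, R₀ ≤ R → c * Real.exp (-c * R ^ 2) ≤ annulusNorm u Du R := by
  obtain ⟨K, hK, hmass⟩ := IsStrongSolution.mass_le hn
  -- The natural rate is `13 = (36 - 10)/2`; one more power of `exp (-R²)` pays for `K` and for the
  -- prefactor `14`. In `R₀`, `6` and `max L 0` meet the conditions of the mass inequality, `K A²`
  -- absorbs the energy term, and `196 K = 14² K` absorbs the constants.
  refine ⟨14, by norm_num, fun A L => ⟨6 + max L 0 + K * A ^ 2 + 196 * K, by positivity, ?_⟩⟩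
  intro V u Du hVm hV hsol hA h1 R hR
  have hL0 : 0 ≤ max L 0 := le_max_right _ _
  have hKA : 0 ≤ K * A ^ 2 := by positivity
  have hLR : 3 * max L 0 ^ 2 ≤ 127 * R ^ 2 := by
    have h2 : max L 0 ^ 2 ≤ R ^ 2 := by gcongr; linarith
    linarith [sq_nonneg R]
  have key := hmass (max L 0) R (by linarith) hLR hL0 V u Du hVm
    (hV.trans (ENNReal.ofReal_le_ofReal (le_max_left _ _))) hsol
  rw [← hsol.curve.annulusNorm_sq, ← hsol.curve.integral_energy_eq] at key
  have hQ : IntegrableOn (fun p : ℝ × EuclideanSpace ℝ (Fin n) => ‖u p.1 p.2‖ ^ 2)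
      (Set.Icc (1 / 2 - 1 / 8 : ℝ) (1 / 2 + 1 / 8) ×ˢ
        {x : EuclideanSpace ℝ (Fin n) | ‖x‖ < 1}) volume := by
    have h2 : IntegrableOn (fun p : ℝ × EuclideanSpace ℝ (Fin n) => ‖u p.1 p.2‖ ^ 2)
        (strip n) volume := by
      rw [IntegrableOn, ← stripMeasure_eq_restrict]
      exact hsol.curve.memLp_strip_fun.integrable_norm_pow (by norm_num)
    refine h2.mono_set (Set.prod_mono (Set.Icc_subset_Icc ?_ ?_) (Set.subset_univ _)) <;> norm_num
  rw [intervalIntegral_eq_setIntegral_prod (by norm_num) hQ] at h1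
  have hexp : ∀ m : ℕ, Real.exp (m * R ^ 2) = Real.exp (R ^ 2) ^ m := fun m => Real.exp_nat_mul _ _
  have e10 := hexp 10
  have e9 := hexp 9
  have e36 := hexp 36
  push_cast at e10 e9 e36
  rw [e10, e9, e36] at key
  have hRX : R ≤ Real.exp (R ^ 2) := by
    nlinarith [Real.add_one_le_exp (R ^ 2)]
  set X := Real.exp (R ^ 2) with hX
  have hX0 : 0 < X := Real.exp_pos _
  have hδ0 : 0 ≤ annulusNorm u Du R := Real.sqrt_nonneg _
  have k1 : R ^ 2 * X ^ 10 ≤ R ^ 2 * X ^ 10 * ∫ p in Set.Icc (1 / 2 - 1 / 8 : ℝ) (1 / 2 + 1 / 8) ×ˢ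
        {x : EuclideanSpace ℝ (Fin n) | ‖x‖ < 1}, ‖u p.1 p.2‖ ^ 2 :=
    le_mul_of_one_le_right (by positivity) h1
  have k2 : K * X ^ 9 * (∫ t in (0 : ℝ)..1, ∫ x, (‖u t x‖ ^ 2 + ‖Du t x‖ ^ 2)) ≤ X ^ 10 :=
    calc _ ≤ K * X ^ 9 * A ^ 2 := by gcongr
      _ = (K * A ^ 2) * X ^ 9 := by ring
      _ ≤ X * X ^ 9 := by gcongr; linarith
      _ = X ^ 10 := by ring
  have k3 : X ^ 10 ≤ K * X ^ 36 * annulusNorm u Du R ^ 2 := by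
    -- One of the two copies of `X ^ 10` cancels the energy term bounded in `k2`.
    have h2 : 2 * X ^ 10 ≤ R ^ 2 * X ^ 10 := by gcongr; nlinarith
    linarith
  have k4 : 14 ^ 2 ≤ (X ^ 14 * annulusNorm u Du R) ^ 2 := by
    have h2 : 196 * K ≤ X := by linarith
    have h3 : 1 ≤ K * (X ^ 13 * annulusNorm u Du R) ^ 2 := by
      refine le_of_mul_le_mul_left ?_ (pow_pos hX0 10)
      calc _ ≤ _ := (mul_one _).le.trans k3
        _ = _ := by ring
    have h4 : 1 ≤ X := by linarith
    calc (14 : ℝ) ^ 2 ≤ 196 * (K * (X ^ 13 * annulusNorm u Du R) ^ 2) := by linarith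
      _ = 196 * K * (X ^ 13 * annulusNorm u Du R) ^ 2 := by ring
      _ ≤ X ^ 2 * (X ^ 13 * annulusNorm u Du R) ^ 2 := by
        gcongr
        exact h2.trans (le_self_pow₀ h4 (by norm_num))
      _ = _ := by ring
  have k5 : 14 ≤ X ^ 14 * annulusNorm u Du R :=
    le_of_sq_le_sq k4 (by positivity)
  have hneg : Real.exp (-14 * R ^ 2) = (X ^ 14)⁻¹ := by
    rw [hX, ← Real.exp_nat_mul, ← Real.exp_neg]
    congr 1
    push_cast
    ring
  rw [hneg, mul_inv_le_iff₀ (by positivity), mul_comm]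
  exact k5
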